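/- \textbf{Setting.} All systems are finite-dimensional. A \emph{quantum network} $\mathfrak N$ is a finite set of completely positive (CP) maps, each with finitely many labelled input and output systems, together with a set of compositions $O\hookrightarrow I$ joining an output to an input of equal dimension by loop composition, $\rho\mapsto\sum_{i,j}\langle i|\mathcal M(\rho\otimes|i\rangle\langle j|)|j\rangle$; each system is in at most one composition, joined systems are identified, and cycles are allowed. A sub-network (a subset of the maps and of the compositions between them) has an \emph{induced map} from its free inputs to its free outputs. A set $S_1$ of inputs of a map $\mathcal M$ \emph{signals} to a set $S_2$ of its outputs if $\mathrm{Tr}_{\mathrm{Out}\setminus S_2}\circ\mathcal M\neq\mathrm{Tr}_{\mathrm{Out}\setminus S_2}\circ\mathcal M\circ\mathcal I$ for some CPTP map $\mathcal I$ acting locally on $S_1$; in a network, $S_1$ signals to $S_2$ if it does so in the induced map of some sub-network. A map $\mathcal M^f$ is a \emph{fine-graining} of $\mathcal M$ with respect to an assignment $F$ of disjoint non-empty sets of systems to the systems of $\mathcal M$ if its inputs and outputs are those in the sets $F(I)$, respectively $F(O)$, with $I$ an input and $O$ an output of $\mathcal M$; if $\mathcal M=\mathrm{Dec}\circ\mathcal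 M^f\circ\mathrm{Enc}$ with $\mathrm{Enc}$ CPTP and $\mathrm{Dec}$ linear and CPTP on the image of $\mathcal M^f\circ\mathrm{Enc}$; and if $S_1$ signalling to $S_2$ in $\mathcal M$ implies that $F(S_1)$ signals to $F(S_2)$ in $\mathcal M^f$. A network $\mathfrak N^f$ is a fine-graining of $\mathfrak N$ if there is an $F$ on the systems of $\mathfrak N$ such that to every sub-network of $\mathfrak N$ there corresponds a sub-network of $\mathfrak N^f$ whose induced map is a fine-graining of that of the former; here different maps of $\mathfrak N$ correspond to sub-networks without common maps, and a sub-network corresponds to the one assembled from those of its maps by joining $F(S)$ for each of its compositions $S$. An $N$-party \emph{process matrix} $W$ is a positive semidefinite operator on the lab inputs $A^I_i$ and lab outputs $A^O_i$ of $N$ parties which yields normalised probabilities $\mathrm{Tr}\big((\bigotimes_i M_i)W\big)$ for all local operations. It has \emph{fixed order} if there is a strict partial order on the parties such that, for all local instruments, the outcome statistics of any set of parties closed under taking pasts does not depend on the instruments of the other parties. Its \emph{process network} $\mathfrak N_{W,N}$ joins the map $\mathcal W$ with Choi matrix $W$, from all $A^O_i$ to all $A^I_i$, with local CPTP maps of the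 parties from $A^I_i$ and a free setting system to $A^O_i$ and a free outcome system. A \emph{spacetime} is a partially ordered set $(\mathcal T,\prec)$. A family of regions (subsets of $\mathcal T$) is a directed graph, its \emph{region causal structure}, with an edge $\mathcal R_1\to\mathcal R_2$ iff $p\prec q$, $p\neq q$, for some $p\in\mathcal R_1$, $q\in\mathcal R_2$. A \emph{spacetime realisation} of $\mathfrak N$ consists of an assignment $\mathcal E$ of regions to its systems, a fine-graining $(\mathfrak N^f,F)$ of $\mathfrak N$, and an assignment $\mathcal E^f$ of regions to the systems of $\mathfrak N^f$ such that the regions of the systems in $F(S)$ partition $\mathcal E(S)$ for every $S$, and the region causal structure on the image of $\mathcal E^f$ is acyclic. It satisfies \emph{relativistic causality} if, for all disjoint sets $S_1,S_2$ of systems of $\mathfrak N^f$ such that $S_1$ signals to $S_2$, there is a directed path in this region causal structure from the region of a system in $S_1$ to the region of a system in $S_2$. A realisation of $\mathfrak N_{W,N}$ has an \emph{input-output correspondence} if, for every party $i$, there is a bijection $e:F(A^I_i)\to F(A^O_i)$ with an edge $\mathcal E^f(P)\to\mathcal E^f(e(P))$ for all $P$. \textbf{Corollary 1.} Let $W$ be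 an $N$-party process matrix. No spacetime realisation of a process network $\mathfrak N_{W,N}$ that has an input-output correspondence can simultaneously satisfy the following: \begin{enumerate} \item relativistic causality; \item absence of any explanation by a process with a definite, acyclic causal order. That is, there are no $M\ge N$ and no fixed order process $W^f$ of $M$ (possibly communicating) parties such that the sub-network of $\mathfrak N^f$ corresponding to the whole of $\mathfrak N_{W,N}$ is a network associated with $W^f$: each of the $M$ parties belongs to one of the $N$ agents $A_i$ and has its lab input in $F(A^I_i)$ and its lab output in $F(A^O_i)$; and the sub-network consists of a part with induced map $\mathcal W^f$, from all lab outputs to all lab inputs of the $M$ parties, and, for each agent, a part with CPTP induced map acting on the lab systems of the parties of that agent (and possibly on further free systems), these parts having no maps in common and being joined along the lab systems. \end{enumerate} -/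

import Mathlib

namespace QNet

open Matrix
open scoped ComplexOrder

/-! ### Linear maps between matrix algebras -/

section Maps

variable {α β : Type*}

/-- The amplification `id_n ⊗ Φ` of a linear map between matrix algebras. -/
def ampl (n : ℕ) (Φ : Matrix α α ℂ →ₗ[ℂ] Matrix β β ℂ)
    (X : Matrix (Fin n × α) (Fin n × α) ℂ) : Matrix (Fin n × β) (Fin n × β) ℂ :=
  Matrix.of fun b b' => Φ (Matrix.of fun a a' => X (b.1, a) (b'.1, a')) b.2 b'.2

/-- Complete positivity: all amplifications preserve positive semidefiniteness. -/
def IsCP (Φ : Matrix α α ℂ →ₗ[ℂ] Matrix β β ℂ) : Prop :=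
  ∀ (n : ℕ) (X : Matrix (Fin n × α) (Fin n × α) ℂ), X.PosSemidef → (ampl n Φ X).PosSemidef

/-- Trace preservation. -/
def IsTP [Fintype α] [Fintype β] (Φ : Matrix α α ℂ →ₗ[ℂ] Matrix β β ℂ) : Prop :=
  ∀ X, (Φ X).trace = X.trace

/-- Completely positive trace preserving maps. -/
def IsCPTP [Fintype α] [Fintype β] (Φ : Matrix α α ℂ →ₗ[ℂ] Matrix β β ℂ) : Prop :=
  IsCP Φ ∧ IsTP Φ

/-- `D` is completely positive and trace preserving on the image of `Ψ` (the linear subspace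
`range Ψ` of the matrix algebra on `β`). -/
def IsCPTPOnImage {γ : Type*} [Fintype β] [Fintype γ]
    (D : Matrix β β ℂ →ₗ[ℂ] Matrix γ γ ℂ) (Ψ : Matrix α α ℂ →ₗ[ℂ] Matrix β β ℂ) : Prop :=
  (∀ (n : ℕ) (X : Matrix (Fin n × α) (Fin n × α) ℂ),
      (ampl n Ψ X).PosSemidef → (ampl n D (ampl n Ψ X)).PosSemidef) ∧
    ∀ X, (D (Ψ X)).trace = (Ψ X).trace

/-- The linear map with matrix elements `⟨y| Φ(|x⟩⟨x'|) |y'⟩ = K y y' x x'`. -/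
def ofKernel [Fintype α] (K : β → β → α → α → ℂ) : Matrix α α ℂ →ₗ[ℂ] Matrix β β ℂ where
  toFun ρ := Matrix.of fun y y' => ∑ x, ∑ x', ρ x x' * K y y' x x'
  map_add' ρ σ := by
    ext y y'
    simp [add_mul, Finset.sum_add_distrib]
  map_smul' c ρ := by
    ext y y'
    simp [Finset.mul_sum, mul_assoc]

/-- The Choi matrix `∑ |x⟩⟨x'| ⊗ Φ(|x⟩⟨x'|)`. -/
def choi [DecidableEq α] (Φ : Matrix α α ℂ →ₗ[ℂ] Matrix β β ℂ) :
    Matrix (α × β) (α × β) ℂ :=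
  Matrix.of fun p q => Φ (Matrix.single p.1 q.1 1) p.2 q.2

theorem isCP_ofKernel [Fintype α] [Fintype β] (K : β → β → α → α → ℂ)
    (hK : (Matrix.of fun p q : α × β => K p.2 q.2 p.1 q.1).PosSemidef) :
    IsCP (ofKernel K) := by
  classical
  intro n X hX
  have h := (hX.kronecker hK).conjTranspose_mul_mul_same
    (Matrix.of fun (p : (Fin n × α) × (α × β)) (q : Fin n × β) =>
      if p.1.1 = q.1 ∧ p.1.2 = p.2.1 ∧ p.2.2 = q.2 then (1 : ℂ) else 0)
  refine (congrArg Matrix.PosSemidef ?_).mpr h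
  ext ⟨i, b⟩ ⟨j, b'⟩
  simp only [ampl, ofKernel, LinearMap.coe_mk, AddHom.coe_mk, Matrix.of_apply, Matrix.mul_apply,
    Matrix.conjTranspose_apply, Matrix.kroneckerMap_apply, Fintype.sum_prod_type]
  simp only [ite_and, apply_ite star, star_one, star_zero, ite_mul, one_mul, zero_mul, mul_ite,
    mul_one, mul_zero, Finset.sum_ite_eq, Finset.sum_ite_eq', Finset.mem_univ, if_true,
    Finset.sum_ite_irrel, Finset.sum_const_zero]
  exact Finset.sum_comm

theorem choi_posSemidef [Fintype α] [DecidableEq α] [Fintype β]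
    {Φ : Matrix α α ℂ →ₗ[ℂ] Matrix β β ℂ} (hΦ : IsCP Φ) : (choi Φ).PosSemidef := by
  classical
  let e := Fintype.equivFin α
  let v : Fin (Fintype.card α) × α → ℂ := fun p => if p.1 = e p.2 then 1 else 0
  have hX := Matrix.posSemidef_vecMulVec_self_star v
  have h := (hΦ _ _ hX).submatrix (fun p : α × β => (e p.1, p.2))
  refine (congrArg Matrix.PosSemidef ?_).mpr h
  ext ⟨a, b⟩ ⟨a', b'⟩
  simp only [choi, ampl, Matrix.of_apply, Matrix.submatrix_apply]
  refine congrFun (congrFun (congrArg Φ ?_) b) b'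
  ext c c'
  simp only [Matrix.single_apply, Matrix.of_apply, Matrix.vecMulVec_apply, v, Pi.star_apply,
    EmbeddingLike.apply_eq_iff_eq]
  by_cases h1 : a = c <;> by_cases h2 : a' = c' <;> simp [h1, h2]

end Maps

/-! ### Operations on families of labelled systems -/

section Ops

variable {σ τ : Type} [DecidableEq σ] [DecidableEq τ]

/-- Labels of the computational basis of `⨂_{s ∈ A} ℂ^{d s}`. -/
abbrev Idx (d : σ → ℕ+) (A : Finset σ) : Type := (s : A) → Fin (d s)

/-- Linear maps from operators on the systems in `A` to operators on the systems in `B`.  The same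
label may occur in `A` and in `B`: an input and an output wire that have not been joined. -/
abbrev Op (d : σ → ℕ+) (A : Finset σ) (d' : τ → ℕ+) (B : Finset τ) : Type :=
  Matrix (Idx d A) (Idx d A) ℂ →ₗ[ℂ] Matrix (Idx d' B) (Idx d' B) ℂ

/-- Restriction of a basis label to a subset of the systems. -/
def res {d : σ → ℕ+} {A B : Finset σ} (h : B ⊆ A) (x : Idx d A) : Idx d B :=
  fun s => x ⟨s, h s.2⟩

/-- The basis label on `A` that is `u` on `S ⊆ A` and `w` on `A \ S`. -/
def glue {d : σ → ℕ+} {S A : Finset σ} (_h : S ⊆ A) (u : Idx d S) (w : Idx d (A \ S)) :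
    Idx d A :=
  fun s => if hs : s.1 ∈ S then u ⟨s, hs⟩ else w ⟨s, Finset.mem_sdiff.2 ⟨s.2, hs⟩⟩

/-- Partial trace over `B \ S`. -/
def ptrace (d : σ → ℕ+) {S B : Finset σ} (h : S ⊆ B) : Op d B d S where
  toFun ρ := Matrix.of fun u u' => ∑ w : Idx d (B \ S), ρ (glue h u w) (glue h u' w)
  map_add' ρ ρ' := by
    ext u u'
    simp [Finset.sum_add_distrib]
  map_smul' c ρ := by
    ext u u'
    simp [Finset.mul_sum]

/-- `Φ ⊗ id` on `A`, for a map `Φ` acting on `S ⊆ A`. -/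
def actOn {d : σ → ℕ+} {S A : Finset σ} (h : S ⊆ A) (Φ : Op d S d S) : Op d A d A where
  toFun ρ := Matrix.of fun a a' =>
    Φ (Matrix.of fun u u' => ρ (glue h u (res Finset.sdiff_subset a))
      (glue h u' (res Finset.sdiff_subset a'))) (res h a) (res h a')
  map_add' ρ ρ' := by
    ext a a'
    simp only [Matrix.add_apply, Matrix.of_apply]
    rw [← Matrix.add_apply, ← map_add]
    rfl
  map_smul' c ρ := by
    ext a a'
    simp only [Matrix.smul_apply, Matrix.of_apply, RingHom.id_apply]
    rw [← Matrix.smul_apply, ← map_smul]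
    rfl

/-- `ρ ⊗ |z⟩⟨z'|` on `A`, for `ρ` on `A \ C` and basis labels `z`, `z'` of `C ⊆ A`. -/
def tensorKetBra {d : σ → ℕ+} {C A : Finset σ} (h : C ⊆ A)
    (ρ : Matrix (Idx d (A \ C)) (Idx d (A \ C)) ℂ) (z z' : Idx d C) :
    Matrix (Idx d A) (Idx d A) ℂ :=
  Matrix.of fun a a' => ρ (res Finset.sdiff_subset a) (res Finset.sdiff_subset a') *
    Matrix.single z z' (1 : ℂ) (res h a) (res h a')

/-- Loop composition of the outputs in `C` with the inputs in `C`: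
`ρ ↦ ∑_{z,z'} ⟨z| Φ(ρ ⊗ |z⟩⟨z'|) |z'⟩`. -/
def loop {d : σ → ℕ+} {C A B : Finset σ} (hA : C ⊆ A) (hB : C ⊆ B) (Φ : Op d A d B) :
    Op d (A \ C) d (B \ C) where
  toFun ρ := Matrix.of fun y y' =>
    ∑ z : Idx d C, ∑ z' : Idx d C, Φ (tensorKetBra hA ρ z z') (glue hB z y) (glue hB z' y')
  map_add' ρ ρ' := by
    have h : ∀ z z' : Idx d C, tensorKetBra hA (ρ + ρ') z z' =
        tensorKetBra hA ρ z z' + tensorKetBra hA ρ' z z' := fun z z' => by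
      ext a a'
      simp [tensorKetBra, add_mul]
    ext y y'
    simp [h, Finset.sum_add_distrib]
  map_smul' c ρ := by
    have h : ∀ z z' : Idx d C, tensorKetBra hA (c • ρ) z z' = c • tensorKetBra hA ρ z z' :=
      fun z z' => by
        ext a a'
        simp only [tensorKetBra, Matrix.of_apply, Matrix.smul_apply, smul_eq_mul, mul_assoc]
    ext y y'
    simp [h, Finset.mul_sum]

/-- The set `SI` of inputs of `Φ` signals to the set `SO` of outputs of `Φ`: some local CPTP
intervention on `SI` changes the reduced output on `SO`. -/
def Signals {d : σ → ℕ+} {A B : Finset σ} (Φ : Op d A d B) (SI SO : Finset σ) : Prop :=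
  ∃ (hI : SI ⊆ A) (hO : SO ⊆ B) (I : Op d SI d SI), IsCPTP I ∧
    ptrace d hO ∘ₗ Φ ≠ ptrace d hO ∘ₗ Φ ∘ₗ actOn hI I

/-- `Φf` is a fine-graining of `Φ` with respect to the assignment `F` of sets of systems. -/
def IsFineGraining {d : σ → ℕ+} {d' : τ → ℕ+} {A B : Finset σ} {A' B' : Finset τ}
    (F : σ → Finset τ) (Φ : Op d A d B) (Φf : Op d' A' d' B') : Prop :=
  A' = A.biUnion F ∧ B' = B.biUnion F ∧
  (∃ (Enc : Op d A d' A') (Dec : Op d' B' d B),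
    IsCPTP Enc ∧ IsCPTPOnImage Dec (Φf ∘ₗ Enc) ∧ Φ = Dec ∘ₗ Φf ∘ₗ Enc) ∧
  ∀ SI SO, Signals Φ SI SO → Signals Φf (SI.biUnion F) (SO.biUnion F)

end Ops

/-! ### Quantum networks -/

/-- A (possibly cyclic) quantum network.  `Sys` is the set of systems after identification of
composed outputs and inputs: a system is an output of `producer s` (if any) and an input of
`consumer s` (if any), and the compositions are the systems which have both.  Producer and consumer
may coincide. -/
structure Network where
  Sys : Type
  Node : Type
  [fintypeSys : Fintype Sys]
  [decEqSys : DecidableEq Sys]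
  [fintypeNode : Fintype Node]
  [decEqNode : DecidableEq Node]
  dim : Sys → ℕ+
  consumer : Sys → Option Node
  producer : Sys → Option Node
  attached : ∀ s, consumer s ≠ none ∨ producer s ≠ none
  map : ∀ v : Node, Op dim (Finset.univ.filter fun s => consumer s = some v)
    dim (Finset.univ.filter fun s => producer s = some v)
  map_cp : ∀ v, IsCP (map v)

attribute [instance] Network.fintypeSys Network.decEqSys Network.fintypeNode Network.decEqNode

namespace Network

variable (𝔑 : Network)

/-- The inputs of the maps in `V`, before composition. -/
def allIn (V : Finset 𝔑.Node) : Finset 𝔑.Sys :=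
  Finset.univ.filter fun s => ∃ v ∈ V, 𝔑.consumer s = some v

/-- The outputs of the maps in `V`, before composition. -/
def allOut (V : Finset 𝔑.Node) : Finset 𝔑.Sys :=
  Finset.univ.filter fun s => ∃ v ∈ V, 𝔑.producer s = some v

theorem ins_subset {V : Finset 𝔑.Node} (v : V) :
    (Finset.univ.filter fun s => 𝔑.consumer s = some v.1) ⊆ 𝔑.allIn V := fun s hs => by
  simp only [Finset.mem_filter, Finset.mem_univ, true_and, allIn] at hs ⊢
  exact ⟨v.1, v.2, hs⟩

theorem outs_subset {V : Finset 𝔑.Node} (v : V) :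
    (Finset.univ.filter fun s => 𝔑.producer s = some v.1) ⊆ 𝔑.allOut V := fun s hs => by
  simp only [Finset.mem_filter, Finset.mem_univ, true_and, allOut] at hs ⊢
  exact ⟨v.1, v.2, hs⟩

/-- The tensor product of the maps in `V`. -/
def tensorMaps (V : Finset 𝔑.Node) : Op 𝔑.dim (𝔑.allIn V) 𝔑.dim (𝔑.allOut V) :=
  ofKernel fun y y' x x' => ∏ v : V,
    𝔑.map v.1 (Matrix.single (res (𝔑.ins_subset v) x) (res (𝔑.ins_subset v) x') 1)
      (res (𝔑.outs_subset v) y) (res (𝔑.outs_subset v) y')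

/-- A sub-network: a subset of the maps and a subset of the compositions between them. -/
@[ext] structure Sub where
  maps : Finset 𝔑.Node
  comps : Finset 𝔑.Sys
  comps_in : comps ⊆ 𝔑.allIn maps
  comps_out : comps ⊆ 𝔑.allOut maps

variable {𝔑}

namespace Sub

/-- Free inputs of a sub-network. -/
def inputs (S : 𝔑.Sub) : Finset 𝔑.Sys := 𝔑.allIn S.maps \ S.comps

/-- Free outputs of a sub-network. -/
def outputs (S : 𝔑.Sub) : Finset 𝔑.Sys := 𝔑.allOut S.maps \ S.comps

/-- The induced map of a sub-network. -/
def induced (S : 𝔑.Sub) : Op 𝔑.dim S.inputs 𝔑.dim S.outputs :=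
  loop S.comps_in S.comps_out (𝔑.tensorMaps S.maps)

/-- The sub-network formed by a single map, without compositions. -/
def single (v : 𝔑.Node) : 𝔑.Sub := ⟨{v}, ∅, Finset.empty_subset _, Finset.empty_subset _⟩

variable (𝔑) in
/-- The whole network. -/
def full : 𝔑.Sub where
  maps := Finset.univ
  comps := 𝔑.allIn Finset.univ ∩ 𝔑.allOut Finset.univ
  comps_in := Finset.inter_subset_left
  comps_out := Finset.inter_subset_right

end Sub

/-- The signalling structure of a network: there is an edge `S₁ ⟶ S₂` if `S₁` signals to `S₂` in
the induced map of some sub-network. -/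
def SignalsTo (𝔑 : Network) (S₁ S₂ : Finset 𝔑.Sys) : Prop :=
  ∃ S : 𝔑.Sub, Signals S.induced S₁ S₂

end Network

/-- `𝔑f` is a fine-graining of `𝔑`.  `F` assigns disjoint non-empty sets of systems of `𝔑f` to the
systems of `𝔑`; `corr` assigns to each sub-network of `𝔑` the corresponding sub-network of `𝔑f`:
disjoint sub-networks correspond to distinct maps, and a sub-network of `𝔑` corresponds to the
sub-network assembled from those of its maps by joining `F s` for each of its compositions `s`. -/
structure FineGraining (𝔑 𝔑f : Network) where
  F : 𝔑.Sys → Finset 𝔑f.Sys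
  F_nonempty : ∀ s, (F s).Nonempty
  F_disjoint : ∀ s t, s ≠ t → Disjoint (F s) (F t)
  corr : 𝔑.Sub → 𝔑f.Sub
  corr_disjoint : ∀ v w, v ≠ w →
    Disjoint (corr (Network.Sub.single v)).maps (corr (Network.Sub.single w)).maps
  corr_maps : ∀ S : 𝔑.Sub,
    (corr S).maps = S.maps.biUnion fun v => (corr (Network.Sub.single v)).maps
  corr_comps : ∀ S : 𝔑.Sub,
    (corr S).comps =
      (S.maps.biUnion fun v => (corr (Network.Sub.single v)).comps) ∪ S.comps.biUnion F
  fine : ∀ S : 𝔑.Sub, IsFineGraining F S.induced (corr S).induced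

/-! ### Spacetime realisations -/

/-- The order relation on regions of a spacetime: some point of `R₁` lies strictly before some point
of `R₂`. -/
def RegionPrec {T : Type*} [PartialOrder T] (R₁ R₂ : Set T) : Prop :=
  ∃ p ∈ R₁, ∃ q ∈ R₂, p < q

/-- The region causal structure on the regions in the image of `E`. -/
def RegionEdge {σ T : Type*} [PartialOrder T] (E : σ → Set T) (R₁ R₂ : Set T) : Prop :=
  R₁ ∈ Set.range E ∧ R₂ ∈ Set.range E ∧ RegionPrec R₁ R₂

/-- The region causal structure on the image of `E` has no directed cycle (in particular no edge
from a region to itself). -/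
def RegionAcyclic {σ T : Type*} [PartialOrder T] (E : σ → Set T) : Prop :=
  ∀ R, ¬ Relation.TransGen (RegionEdge E) R R

/-- A spacetime realisation of `𝔑` in the spacetime `T`: an embedding of `𝔑`, and a fine-graining of
`𝔑` embedded in a partition of the regions, with an acyclic region causal structure. -/
structure Realisation (𝔑 : Network) (T : Type*) [PartialOrder T] where
  embed : 𝔑.Sys → Set T
  fine : Network
  fg : FineGraining 𝔑 fine
  fineEmbed : fine.Sys → Set T
  partition_union : ∀ s, ⋃ t ∈ fg.F s, fineEmbed t = embed s
  partition_disjoint : ∀ s, ∀ t ∈ fg.F s, ∀ t' ∈ fg.F s, t ≠ t' →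
    Disjoint (fineEmbed t) (fineEmbed t')
  acyclic : RegionAcyclic fineEmbed

/-- Relativistic causality: signalling between disjoint sets of systems of the fine-grained network
only occurs along directed paths of the fine-grained region causal structure. -/
def Realisation.RelativisticCausality {𝔑 : Network} {T : Type*} [PartialOrder T]
    (R : Realisation 𝔑 T) : Prop :=
  ∀ S₁ S₂ : Finset R.fine.Sys, Disjoint S₁ S₂ → R.fine.SignalsTo S₁ S₂ →
    ∃ s₁ ∈ S₁, ∃ s₂ ∈ S₂,
      Relation.ReflTransGen (RegionEdge R.fineEmbed) (R.fineEmbed s₁) (R.fineEmbed s₂)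

/-! ### Process matrices -/

/-- Linear maps from operators on `ℂ^a` to operators on `ℂ^b`. -/
abbrev LocalMap (a b : ℕ+) : Type := Matrix (Fin a) (Fin a) ℂ →ₗ[ℂ] Matrix (Fin b) (Fin b) ℂ

/-- The tensor product of the (transposed) Choi matrices of local maps. -/
def localChoi {P : Type} [Fintype P] {dI dO : P → ℕ+} (M : ∀ p, LocalMap (dI p) (dO p)) :
    Matrix ((∀ p, Fin (dI p)) × (∀ p, Fin (dO p))) ((∀ p, Fin (dI p)) × (∀ p, Fin (dO p))) ℂ :=
  Matrix.of fun a b => ∏ p, M p (Matrix.single (b.1 p) (a.1 p) 1) (b.2 p) (a.2 p)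

/-- A process matrix for the parties `P` with lab inputs of dimension `dI` and lab outputs of
dimension `dO`: a positive semidefinite operator yielding normalised probabilities for all local
operations. -/
structure ProcMatrix (P : Type) [Fintype P] [DecidableEq P] (dI dO : P → ℕ+) where
  mat : Matrix ((∀ p, Fin (dI p)) × (∀ p, Fin (dO p))) ((∀ p, Fin (dI p)) × (∀ p, Fin (dO p))) ℂ
  posSemidef : mat.PosSemidef
  normalised : ∀ M : ∀ p, LocalMap (dI p) (dO p), (∀ p, IsCPTP (M p)) →
    (localChoi M * mat).trace = 1

/-- A quantum instrument with `k` outcomes. -/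
def IsInstrument {a b : ℕ+} {k : ℕ} (J : Fin k → LocalMap a b) : Prop :=
  (∀ x, IsCP (J x)) ∧ IsTP (∑ x, J x)

namespace ProcMatrix

variable {P : Type} [Fintype P] [DecidableEq P] {dI dO : P → ℕ+}

/-- The probability rule `Tr((⨂ M_p) W)`. -/
def prob (W : ProcMatrix P dI dO) (M : ∀ p, LocalMap (dI p) (dO p)) : ℂ :=
  (localChoi M * W.mat).trace

/-- A fixed order process: for some strict partial order `r` on the parties and for all choices of
local instruments, the outcome statistics of every set `L` of parties that contains the past of each
of its members does not depend on the instruments of the parties outside `L`. -/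
def IsFixedOrder (W : ProcMatrix P dI dO) : Prop :=
  ∃ r : P → P → Prop, (∀ p, ¬ r p p) ∧ (∀ p q s, r p q → r q s → r p s) ∧
    ∀ L : Finset P, (∀ p ∈ L, ∀ q, r q p → q ∈ L) →
      ∀ (k : P → ℕ) (J J' : ∀ p, Fin (k p) → LocalMap (dI p) (dO p)),
        (∀ p, IsInstrument (J p)) → (∀ p, IsInstrument (J' p)) → (∀ p ∈ L, J p = J' p) →
        ∀ x : ∀ p, Fin (k p),
          (∑ y : ∀ p, Fin (k p) with ∀ p ∈ L, y p = x p, W.prob fun p => J p (y p)) =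
            ∑ y : ∀ p, Fin (k p) with ∀ p ∈ L, y p = x p, W.prob fun p => J' p (y p)

end ProcMatrix

/-! ### Process networks -/

/-- The systems of a process network. -/
inductive ProcSys (P : Type) : Type
  | labIn (p : P)
  | labOut (p : P)
  | setting (p : P)
  | outcome (p : P)
  deriving DecidableEq, Fintype

/-- Local operations of the parties: CPTP maps from the lab input and a setting system to the lab
output and an outcome system. -/
structure LocalOps (P : Type) (dI dO dS dX : P → ℕ+) where
  op : ∀ p, Matrix (Fin (dI p) × Fin (dS p)) (Fin (dI p) × Fin (dS p)) ℂ →ₗ[ℂ]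
    Matrix (Fin (dO p) × Fin (dX p)) (Fin (dO p) × Fin (dX p)) ℂ
  cptp : ∀ p, IsCPTP (op p)

section ProcNetwork

variable {P : Type} [Fintype P] [DecidableEq P] {dI dO dS dX : P → ℕ+}

/-- Dimensions of the systems of a process network. -/
def procDim (dI dO dS dX : P → ℕ+) : ProcSys P → ℕ+
  | .labIn p => dI p
  | .labOut p => dO p
  | .setting p => dS p
  | .outcome p => dX p

/-- The map that consumes a system; `none : Option P` labels the process map. -/
def procConsumer : ProcSys P → Option (Option P)
  | .labIn p => some (some p)
  | .labOut _ => some none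
  | .setting p => some (some p)
  | .outcome _ => none

/-- The map that produces a system. -/
def procProducer : ProcSys P → Option (Option P)
  | .labIn _ => some none
  | .labOut p => some (some p)
  | .setting _ => none
  | .outcome p => some (some p)

theorem mem_wires {σ κ : Type} [Fintype σ] [DecidableEq κ] {f : σ → Option κ} {s : σ} {v : κ}
    (h : f s = some v) : s ∈ Finset.univ.filter fun t => f t = some v :=
  Finset.mem_filter.2 ⟨Finset.mem_univ _, h⟩

/-- The maps of a process network: the process map, whose Choi matrix is the process matrix, and the
local operations. -/
def procMap (W : ProcMatrix P dI dO) (L : LocalOps P dI dO dS dX) : ∀ v : Option P,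
    Op (procDim dI dO dS dX) (Finset.univ.filter fun s => procConsumer s = some v)
      (procDim dI dO dS dX) (Finset.univ.filter fun s => procProducer s = some v)
  | none => ofKernel fun y y' x x' =>
      W.mat (fun p => y ⟨.labIn p, mem_wires rfl⟩,
          fun p => x ⟨.labOut p, mem_wires rfl⟩)
        (fun p => y' ⟨.labIn p, mem_wires rfl⟩,
          fun p => x' ⟨.labOut p, mem_wires rfl⟩)
  | some p => ofKernel fun y y' x x' =>
      L.op p (Matrix.single
          (x ⟨.labIn p, mem_wires rfl⟩, x ⟨.setting p, mem_wires rfl⟩)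
          (x' ⟨.labIn p, mem_wires rfl⟩, x' ⟨.setting p, mem_wires rfl⟩) 1)
        (y ⟨.labOut p, mem_wires rfl⟩, y ⟨.outcome p, mem_wires rfl⟩)
        (y' ⟨.labOut p, mem_wires rfl⟩, y' ⟨.outcome p, mem_wires rfl⟩)

theorem procMap_cp (W : ProcMatrix P dI dO) (L : LocalOps P dI dO dS dX) (v : Option P) :
    IsCP (procMap W L v) := by
  cases v with
  | none =>
    apply isCP_ofKernel
    exact W.posSemidef.submatrix
      (fun q : Idx (procDim dI dO dS dX) (Finset.univ.filter fun s => procConsumer s = some none) ×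
          Idx (procDim dI dO dS dX) (Finset.univ.filter fun s => procProducer s = some none) =>
        ((fun p => q.2 ⟨.labIn p, mem_wires rfl⟩,
          fun p => q.1 ⟨.labOut p, mem_wires rfl⟩) :
          (∀ p, Fin (dI p)) × (∀ p, Fin (dO p))))
  | some p =>
    apply isCP_ofKernel
    exact (choi_posSemidef (L.cptp p).1).submatrix
      (fun q : Idx (procDim dI dO dS dX)
            (Finset.univ.filter fun s => procConsumer s = some (some p)) ×
          Idx (procDim dI dO dS dX)
            (Finset.univ.filter fun s => procProducer s = some (some p)) =>
        (((q.1 ⟨.labIn p, mem_wires rfl⟩, q.1 ⟨.setting p, mem_wires rfl⟩),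
          (q.2 ⟨.labOut p, mem_wires rfl⟩, q.2 ⟨.outcome p, mem_wires rfl⟩)) :
          (Fin (dI p) × Fin (dS p)) × (Fin (dO p) × Fin (dX p))))

/-- The process network of `W` with the local operations `L`. -/
def procNetwork (W : ProcMatrix P dI dO) (L : LocalOps P dI dO dS dX) : Network where
  Sys := ProcSys P
  Node := Option P
  dim := procDim dI dO dS dX
  consumer := procConsumer
  producer := procProducer
  attached s := by cases s <;> simp [procConsumer, procProducer]
  map := procMap W L
  map_cp := procMap_cp W L

/-- The input-output correspondence: for each party, the fine-grained lab inputs and lab outputs are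
matched one to one, each input region preceding the matched output region. -/
def InputOutputCorrespondence {T : Type*} [PartialOrder T] {W : ProcMatrix P dI dO}
    {L : LocalOps P dI dO dS dX} (R : Realisation (procNetwork W L) T) : Prop :=
  ∀ p : P, ∃ e : R.fg.F (ProcSys.labIn p) ≃ R.fg.F (ProcSys.labOut p),
    ∀ s, RegionPrec (R.fineEmbed s.1) (R.fineEmbed (e s).1)

end ProcNetwork

/-- The sub-network `S` of `𝔐` is a network associated with the process `W` of the parties `Fin M`,
grouped into agents `Q`: it consists of a part `env` which implements the process map of `W`, from
the lab outputs to the lab inputs of all parties, and, for each agent, a part which implements a CPTP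
operation on the lab inputs and outputs of the parties of that agent (and possibly further free
systems), all joined along the lab inputs and outputs.  The parties of one agent may communicate
within the part of this agent. -/
structure ProcessDecomposition {𝔐 : Network} (S : 𝔐.Sub) {M : ℕ} (labIn labOut : Fin M → 𝔐.Sys)
    (W : ProcMatrix (Fin M) (fun k => 𝔐.dim (labIn k)) (fun k => 𝔐.dim (labOut k)))
    {Q : Type} [Fintype Q] (agent : Fin M → Q) where
  env : 𝔐.Sub
  lab : Q → 𝔐.Sub
  labIn_injective : Function.Injective labIn
  labOut_injective : Function.Injective labOut
  env_inputs : env.inputs = Finset.univ.image labOut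
  env_outputs : env.outputs = Finset.univ.image labIn
  env_map : ∀ (o o' : Idx 𝔐.dim env.inputs) (i i' : Idx 𝔐.dim env.outputs),
    env.induced (Matrix.single o o' 1) i i' =
      W.mat (fun k => i ⟨labIn k, by simp [env_outputs]⟩,
          fun k => o ⟨labOut k, by simp [env_inputs]⟩)
        (fun k => i' ⟨labIn k, by simp [env_outputs]⟩,
          fun k => o' ⟨labOut k, by simp [env_inputs]⟩)
  lab_inputs : ∀ q k, labIn k ∈ (lab q).inputs ↔ agent k = q
  lab_outputs : ∀ q k, labOut k ∈ (lab q).outputs ↔ agent k = q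
  lab_cptp : ∀ q, IsCPTP (lab q).induced
  env_lab_disjoint : ∀ q, Disjoint env.maps (lab q).maps
  lab_disjoint : ∀ q q', q ≠ q' → Disjoint (lab q).maps (lab q').maps
  maps_eq : S.maps = env.maps ∪ Finset.univ.biUnion fun q => (lab q).maps
  comps_eq : S.comps = env.comps ∪ (Finset.univ.biUnion fun q => (lab q).comps) ∪
    (Finset.univ.image labIn ∪ Finset.univ.image labOut)

/-- The realisation of an `N`-party process network admits a fine-grained explanation by a fixed order
process: the sub-network of the fine-grained network that corresponds to the whole process network is
a network associated with a fixed order process of `M ≥ N` parties, whose lab inputs and outputs are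
the systems into which the lab inputs and outputs of the `N` agents are fine-grained. -/
def HasFixedOrderExplanation {N : ℕ} {dI dO dS dX : Fin N → ℕ+} {T : Type*} [PartialOrder T]
    {W : ProcMatrix (Fin N) dI dO} {L : LocalOps (Fin N) dI dO dS dX}
    (R : Realisation (procNetwork W L) T) : Prop :=
  ∃ (M : ℕ) (agent : Fin M → Fin N) (labIn labOut : Fin M → R.fine.Sys)
    (Wf : ProcMatrix (Fin M) (fun k => R.fine.dim (labIn k)) (fun k => R.fine.dim (labOut k))),
    N ≤ M ∧ Wf.IsFixedOrder ∧
    (∀ k, labIn k ∈ R.fg.F (ProcSys.labIn (agent k))) ∧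
    (∀ k, labOut k ∈ R.fg.F (ProcSys.labOut (agent k))) ∧
    Nonempty (ProcessDecomposition (R.fg.corr (Network.Sub.full (procNetwork W L)))
      labIn labOut Wf agent)

end QNet

namespace QNet

open Matrix
open scoped ComplexOrder

/-! ### Choi matrices and complete positivity. -/

section Kernels

variable {α β : Type*} [Fintype α] [DecidableEq α]

/-! Relativistic causality and the input-output correspondence already force a fixed order
explanation, constructed in `hasFixedOrderExplanation`. A fine-grained party is one fine-grained lab
input together with the lab output matched to it by the correspondence. The process `Wf` is the Choi
matrix of the fine-grained sub-network that corresponds to the process map.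

Party `k` precedes party `l` when a directed path of regions leads from the output of `k` to the
input of `l`. Since each input region has an edge to its matched output region, paths can be
concatenated, and `k` preceding itself would close a cycle. Acyclicity therefore makes this a strict
partial order, and relativistic causality says that the output of `k` can signal to a set of lab
inputs only if the set contains the input of a party after `k`.

Parties can then be eliminated from the latest to the earliest (`opProb_eq_piecewise`). If all
parties after `k` discard their inputs, then nothing that remains depends on the output of `k`, so a
trace preserving operation of `k` may be replaced by discarding its input and preparing a fixed
state. Eliminating everyone gives normalisation (`opProb_eq_one`); eliminating the complement of a
past-closed set gives the fixed order property (`ProcMatrix.isFixedOrder_ofMap`).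

The fine-grained maps must also be trace preserving, although a fine-graining constrains them only
on the image of the encoder. Here relativistic causality is applied with an empty target: no
signalling to the empty set makes the output trace a constant multiple of the input trace, and a
single normalised input of the coarse map fixes the constant to be one (`IsFineGraining.isTP`). -/

theorem apply_eq_sum_single (Φ : Matrix α α ℂ →ₗ[ℂ] Matrix β β ℂ) (X : Matrix α α ℂ) (y y' : β) :
    Φ X y y' = ∑ x, ∑ x', X x x' * Φ (Matrix.single x x' 1) y y' := by
  conv_lhs => rw [Matrix.matrix_eq_sum_single X]
  simp only [map_sum, Matrix.sum_apply]
  refine Finset.sum_congr rfl fun x _ => Finset.sum_congr rfl fun x' _ => ?_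
  have : Matrix.single x x' (X x x') = X x x' • Matrix.single x x' (1 : ℂ) := by
    rw [Matrix.smul_single, smul_eq_mul, mul_one]
  rw [this, map_smul, Matrix.smul_apply, smul_eq_mul]

theorem ofKernel_apply_single (K : β → β → α → α → ℂ) (x x' : α) (y y' : β) :
    ofKernel K (Matrix.single x x' 1) y y' = K y y' x x' := by
  simp only [ofKernel, LinearMap.coe_mk, AddHom.coe_mk, Matrix.of_apply, Matrix.single_apply,
    ite_and, ite_mul, one_mul, zero_mul]
  simp

theorem isCP_of_choi_posSemidef [Fintype β] {Φ : Matrix α α ℂ →ₗ[ℂ] Matrix β β ℂ}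
    (h : (choi Φ).PosSemidef) : IsCP Φ := by
  have hΦ : Φ = ofKernel fun y y' x x' => Φ (Matrix.single x x' 1) y y' := by
    ext1 X
    ext y y'
    rw [apply_eq_sum_single]
    rfl
  rw [hΦ]
  exact isCP_ofKernel _ h

/-- Schur product theorem, iterated; the empty product is the rank-one all-ones matrix. -/
theorem posSemidef_prod {ι κ : Type*} [Finite κ] (s : Finset ι) (A : ι → Matrix κ κ ℂ)
    (hA : ∀ i ∈ s, (A i).PosSemidef) :
    (Matrix.of fun p q => ∏ i ∈ s, A i p q).PosSemidef := by
  classical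
  induction s using Finset.induction_on with
  | empty =>
    refine (congrArg Matrix.PosSemidef ?_).mpr
      (Matrix.posSemidef_vecMulVec_self_star (fun _ : κ => (1 : ℂ)))
    ext p q
    simp [Matrix.vecMulVec_apply]
  | insert i s hi ih =>
    refine (congrArg Matrix.PosSemidef ?_).mpr ((hA i (Finset.mem_insert_self _ _)).hadamard
      (ih fun j hj => hA j (Finset.mem_insert_of_mem hj)))
    ext p q
    simp [Finset.prod_insert hi]

end Kernels

/-! ### Discard-and-prepare channels. -/

section Prepare

variable {α β : Type*} [Fintype α]

/-- Discard the system and prepare the basis state `z`. -/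
def prep [DecidableEq β] (z : β) : Matrix α α ℂ →ₗ[ℂ] Matrix β β ℂ where
  toFun X := X.trace • Matrix.single z z 1
  map_add' X Y := by rw [Matrix.trace_add, add_smul]
  map_smul' c X := by rw [Matrix.trace_smul, smul_assoc, RingHom.id_apply]

theorem prep_apply [DecidableEq β] (z : β) (X : Matrix α α ℂ) :
    prep z X = X.trace • Matrix.single z z (1 : ℂ) := rfl

theorem isTP_prep [Fintype β] [DecidableEq β] (z : β) :
    IsTP (prep z : Matrix α α ℂ →ₗ[ℂ] Matrix β β ℂ) := fun X => by
  rw [prep_apply, Matrix.trace_smul, Matrix.trace_single_eq_same, smul_eq_mul, mul_one]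

theorem isCP_prep [Fintype β] [DecidableEq β] (z : β) :
    IsCP (prep z : Matrix α α ℂ →ₗ[ℂ] Matrix β β ℂ) := by
  classical
  apply isCP_of_choi_posSemidef
  have h : (Matrix.single z z (1 : ℂ)).PosSemidef := by
    rw [← Matrix.diagonal_single]
    exact Matrix.PosSemidef.diagonal (by intro b; by_cases h : b = z <;> simp [h])
  -- The Choi matrix of this channel is the identity tensored with the projector on `z`.
  refine (congrArg Matrix.PosSemidef ?_).mpr ((Matrix.PosSemidef.one (n := α)).kronecker h)
  ext p q
  simp only [choi, Matrix.of_apply, prep_apply, Matrix.smul_apply, Matrix.kroneckerMap_apply,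
    Matrix.one_apply, smul_eq_mul]
  by_cases hpq : p.1 = q.1
  · rw [hpq, Matrix.trace_single_eq_same, if_pos rfl]
  · rw [Matrix.trace_single_eq_of_ne _ _ _ hpq, if_neg hpq]

theorem isCPTP_prep [Fintype β] [DecidableEq β] (z : β) :
    IsCPTP (prep z : Matrix α α ℂ →ₗ[ℂ] Matrix β β ℂ) :=
  ⟨isCP_prep z, isTP_prep z⟩

/-- This is how a local operation gets erased: once its output is discarded, only its effect on the
trace survives. -/
theorem prep_comp_of_isTP {γ : Type*} [Fintype γ] [DecidableEq β]
    {Φ : Matrix α α ℂ →ₗ[ℂ] Matrix γ γ ℂ} (hΦ : IsTP Φ) (z : β) : prep z ∘ₗ Φ = prep z := by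
  ext1 X
  rw [LinearMap.comp_apply, prep_apply, prep_apply, hΦ X]

end Prepare

/-! ### Splitting basis labels, loop composition and partial trace. -/

section Systems

variable {σ : Type} [DecidableEq σ] {d : σ → ℕ+}

theorem res_glue_left {S A : Finset σ} (h : S ⊆ A) (u : Idx d S) (w : Idx d (A \ S)) :
    res h (glue h u w) = u := by
  funext s
  simp [res, glue, s.2]

theorem res_glue_right {S A : Finset σ} (h : S ⊆ A) (u : Idx d S) (w : Idx d (A \ S)) :
    res Finset.sdiff_subset (glue h u w) = w := by
  funext s
  simp [res, glue, (Finset.mem_sdiff.1 s.2).2]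

theorem glue_res {S A : Finset σ} (h : S ⊆ A) (a : Idx d A) :
    glue h (res h a) (res Finset.sdiff_subset a) = a := by
  funext s
  simp [res, glue]

/-- Basis labels on `A` are pairs of basis labels on `S ⊆ A` and on `A \ S`. -/
def glueEquiv {S A : Finset σ} (h : S ⊆ A) : Idx d S × Idx d (A \ S) ≃ Idx d A where
  toFun p := glue h p.1 p.2
  invFun a := (res h a, res Finset.sdiff_subset a)
  left_inv _ := Prod.ext (res_glue_left h _ _) (res_glue_right h _ _)
  right_inv a := glue_res h a

theorem res_bijective {S A : Finset σ} (h : S ⊆ A) (h' : A ⊆ S) :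
    Function.Bijective (res h : Idx d A → Idx d S) := by
  obtain rfl := Finset.Subset.antisymm h h'
  exact Function.bijective_id

theorem sum_glue {S A : Finset σ} (h : S ⊆ A) (f : Idx d A → ℂ) :
    ∑ a, f a = ∑ u : Idx d S, ∑ w : Idx d (A \ S), f (glue h u w) := by
  rw [← Fintype.sum_prod_type', ← (glueEquiv h).sum_comp]
  rfl

theorem eq_glue_iff {S A : Finset σ} (h : S ⊆ A) (u : Idx d S) (w : Idx d (A \ S)) (a : Idx d A) :
    glue h u w = a ↔ u = res h a ∧ w = res Finset.sdiff_subset a := by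
  constructor
  · rintro rfl
    rw [res_glue_left, res_glue_right]
    exact ⟨rfl, rfl⟩
  · rintro ⟨rfl, rfl⟩
    exact glue_res h a

theorem tensorKetBra_single {C A : Finset σ} (h : C ⊆ A) (x x' : Idx d (A \ C)) (z z' : Idx d C) :
    tensorKetBra h (Matrix.single x x' 1) z z' =
      Matrix.single (glue h z x) (glue h z' x') 1 := by
  ext a a'
  simp only [tensorKetBra, Matrix.of_apply, Matrix.single_apply, eq_glue_iff]
  rw [ite_zero_mul_ite_zero, mul_one]
  refine if_congr ?_ rfl rfl
  tauto

theorem loop_apply_single {C A B : Finset σ} (hA : C ⊆ A) (hB : C ⊆ B) (Φ : Op d A d B)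
    (x x' : Idx d (A \ C)) (y y' : Idx d (B \ C)) :
    loop hA hB Φ (Matrix.single x x' 1) y y' =
      ∑ z : Idx d C, ∑ z' : Idx d C,
        Φ (Matrix.single (glue hA z x) (glue hA z' x') 1) (glue hB z y) (glue hB z' y') := by
  simp only [loop, LinearMap.coe_mk, AddHom.coe_mk, Matrix.of_apply, tensorKetBra_single]

theorem IsCP.loop {C A B : Finset σ} (hA : C ⊆ A) (hB : C ⊆ B) {Φ : Op d A d B} (hΦ : IsCP Φ) :
    IsCP (loop hA hB Φ) := by
  apply isCP_of_choi_posSemidef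
  have h := (choi_posSemidef hΦ).submatrix
    (fun q : Idx d C × (Idx d (A \ C) × Idx d (B \ C)) => (glue hA q.1 q.2.1, glue hB q.1 q.2.2))
  -- Looping sums the Choi matrix over equal labels on both wires of `C`, which is a congruence by
  -- the 0/1 matrix that forgets the looped label.
  have h' := h.conjTranspose_mul_mul_same
    (Matrix.of fun (q : Idx d C × (Idx d (A \ C) × Idx d (B \ C)))
      (p : Idx d (A \ C) × Idx d (B \ C)) => if q.2 = p then (1 : ℂ) else 0)
  refine (congrArg Matrix.PosSemidef ?_).mpr h'
  ext p q
  simp only [choi, Matrix.of_apply, loop_apply_single, Matrix.mul_apply,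
    Matrix.conjTranspose_apply, Matrix.submatrix_apply, Fintype.sum_prod_type (α₁ := Idx d C)]
  simp only [apply_ite star, star_one, star_zero, ite_mul, one_mul, zero_mul, mul_ite,
    mul_one, mul_zero, Finset.sum_ite_eq', Finset.mem_univ, if_true]
  exact Finset.sum_comm

theorem trace_ptrace {S B : Finset σ} (h : S ⊆ B) (X : Matrix (Idx d B) (Idx d B) ℂ) :
    (ptrace d h X).trace = X.trace := by
  simp only [Matrix.trace, Matrix.diag, sum_glue h, ptrace, LinearMap.coe_mk, AddHom.coe_mk,
    Matrix.of_apply]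

end Systems

/-! ### Induced maps of sub-networks. -/

namespace Network

variable {𝔑 : Network}

theorem isCP_tensorMaps (V : Finset 𝔑.Node) : IsCP (𝔑.tensorMaps V) := by
  apply isCP_ofKernel
  exact posSemidef_prod Finset.univ
    (fun v : V => (choi (𝔑.map v.1)).submatrix
      (fun q : Idx 𝔑.dim (𝔑.allIn V) × Idx 𝔑.dim (𝔑.allOut V) =>
        (res (𝔑.ins_subset v) q.1, res (𝔑.outs_subset v) q.2))
      (fun q => (res (𝔑.ins_subset v) q.1, res (𝔑.outs_subset v) q.2)))
    fun v _ => (choi_posSemidef (𝔑.map_cp v.1)).submatrix _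

theorem Sub.isCP_induced (S : 𝔑.Sub) : IsCP S.induced :=
  (isCP_tensorMaps _).loop _ _

/-- Without compositions the induced map is `𝔑.map v` up to relabelling of the wires. Comparing
traces for some diagonal unit, with its label existentially quantified, avoids transporting maps
between the two index types. -/
theorem Sub.trace_induced_single (v : 𝔑.Node) (x : Idx 𝔑.dim (Sub.single v).inputs) :
    ∃ a, ((Sub.single v).induced (Matrix.single x x 1)).trace =
      (𝔑.map v (Matrix.single a a 1)).trace := by
  have hv : v ∈ ({v} : Finset 𝔑.Node) := Finset.mem_singleton_self v
  -- The unique label of the empty set of composed systems, so sums over it collapse.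
  let z : Idx 𝔑.dim (Sub.single v).comps := fun s => absurd s.2 (Finset.notMem_empty _)
  have hz : ∀ f : Idx 𝔑.dim (Sub.single v).comps → ℂ, ∑ w, f w = f z := fun f =>
    Fintype.sum_eq_single z fun w hw =>
      absurd (funext fun s => absurd s.2 (Finset.notMem_empty _)) hw
  let a := glue (Sub.single v).comps_in z x
  refine ⟨res (𝔑.ins_subset (V := {v}) ⟨v, hv⟩) a, ?_⟩
  have hout : 𝔑.allOut {v} ⊆ Finset.univ.filter fun s => 𝔑.producer s = some v := fun s hs => by
    simpa [allOut] using hs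
  rw [Matrix.trace, Matrix.trace,
    ← (res_bijective (d := 𝔑.dim) (𝔑.outs_subset (V := {v}) ⟨v, hv⟩) hout).sum_comp]
  have h := sum_glue (d := 𝔑.dim) (Sub.single v).comps_out fun b =>
    𝔑.tensorMaps {v} (Matrix.single a a 1) b b
  rw [hz] at h
  refine Eq.trans (Finset.sum_congr rfl fun y _ => ?_) (h.symm.trans
    (Finset.sum_congr rfl fun b _ => ?_))
  · refine (loop_apply_single _ _ _ _ _ _ _).trans ?_
    rw [hz, hz]
    rfl
  · refine (ofKernel_apply_single _ _ _ _ _).trans ?_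
    exact Fintype.prod_eq_single (⟨v, hv⟩ : ({v} : Finset 𝔑.Node)) fun w hw =>
      absurd (Subtype.ext (Finset.mem_singleton.1 w.2)) hw

end Network

/-! ### Absence of signalling to the empty set, and trace preservation. -/

section Signalling

variable {σ τ : Type} [DecidableEq σ] [DecidableEq τ] {d : σ → ℕ+} {d' : τ → ℕ+}

theorem ptrace_eq_of_not_signals {A B SI SO : Finset σ} {Φ : Op d A d B}
    (h : ¬ Signals Φ SI SO) (hI : SI ⊆ A) (hO : SO ⊆ B) {I : Op d SI d SI} (hCPTP : IsCPTP I)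
    (X : Matrix (Idx d A) (Idx d A) ℂ) :
    ptrace d hO (Φ X) = ptrace d hO (Φ (actOn hI I X)) := by
  by_contra hne
  exact h ⟨hI, hO, I, hCPTP, fun heq => hne (LinearMap.congr_fun heq X)⟩

/-- A fixed basis label. -/
def baseIdx (d : σ → ℕ+) (A : Finset σ) : Idx d A := fun s => ⟨0, (d s).pos⟩

theorem actOn_refl {A : Finset σ} (Φ : Op d A d A) (X : Matrix (Idx d A) (Idx d A) ℂ) :
    actOn (Finset.Subset.refl A) Φ X = Φ X := by
  have hg : ∀ (u : Idx d A) (w : Idx d (A \ A)), glue (Finset.Subset.refl A) u w = u :=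
    fun u w => funext fun s => by simp [glue, s.2]
  ext a a'
  simp only [actOn, LinearMap.coe_mk, AddHom.coe_mk, Matrix.of_apply, hg]
  rfl

/-- The reduced output on no systems is the trace, so replacing the whole input by a fixed state of
the same trace cannot change the output trace. -/
theorem trace_eq_of_not_signals_empty {A B : Finset σ} {Φ : Op d A d B}
    (h : ¬ Signals Φ A ∅) (X : Matrix (Idx d A) (Idx d A) ℂ) :
    (Φ X).trace = X.trace * (Φ (Matrix.single (baseIdx d A) (baseIdx d A) 1)).trace := by
  have h1 := congrArg Matrix.trace (ptrace_eq_of_not_signals h (Finset.Subset.refl A)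
    (Finset.empty_subset B) (isCPTP_prep (baseIdx d A)) X)
  rwa [trace_ptrace, trace_ptrace, actOn_refl, prep_apply, map_smul, Matrix.trace_smul,
    smul_eq_mul] at h1

/-- The trace of the output of `Φf` is a fixed multiple of the trace of its input. The encoder and,
on the relevant image, the decoder preserve the trace, so `X` shows that the multiple is one, even
for inputs outside the range of the encoder. -/
theorem IsFineGraining.isTP {A B : Finset σ} {A' B' : Finset τ} {F : σ → Finset τ}
    {Φ : Op d A d B} {Φf : Op d' A' d' B'} (h : IsFineGraining F Φ Φf)
    (hns : ¬ Signals Φf A' ∅) {X : Matrix (Idx d A) (Idx d A) ℂ} (hX : X.trace = 1)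
    (hΦX : (Φ X).trace = 1) : IsTP Φf := by
  obtain ⟨-, -, ⟨Enc, Dec, hEnc, hDec, hΦ⟩, -⟩ := h
  have h1 : (Φf (Enc X)).trace = 1 := by
    rw [← hΦX, hΦ]
    exact (hDec.2 X).symm
  rw [trace_eq_of_not_signals_empty hns, hEnc.2, hX, one_mul] at h1
  intro Y
  rw [trace_eq_of_not_signals_empty hns, h1, mul_one]

end Signalling

/-! ### Normalisation of the maps of a process network. -/

section ProcNetwork

variable {P : Type} [Fintype P] [DecidableEq P] {dI dO dS dX : P → ℕ+}

/-- The normalisation condition, tested on parties that discard their inputs and prepare `o`; their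
joint Choi matrix is the diagonal projector on the labels with output part `o`. -/
theorem ProcMatrix.sum_diag (W : ProcMatrix P dI dO) (o : ∀ p, Fin (dO p)) :
    ∑ i : ∀ p, Fin (dI p), W.mat (i, o) (i, o) = 1 := by
  rw [← W.normalised (fun p => prep (o p)) fun p => isCPTP_prep _]
  have h : (localChoi fun p => (prep (o p) : LocalMap (dI p) (dO p))) =
      Matrix.diagonal fun a => if o = a.2 then 1 else 0 := by
    ext a b
    simp only [localChoi, Matrix.of_apply, prep_apply, Matrix.smul_apply, smul_eq_mul,
      Matrix.diagonal_apply, Matrix.single_apply, mul_ite, mul_one, mul_zero]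
    by_cases hab : a = b
    · subst hab
      rw [if_pos rfl]
      simp only [Matrix.trace_single_eq_same, and_self]
      by_cases ho : o = a.2
      · simp [ho]
      · obtain ⟨p, hp⟩ := Function.ne_iff.1 ho
        rw [if_neg ho]
        exact Finset.prod_eq_zero (Finset.mem_univ p) (if_neg hp)
    · rw [if_neg hab]
      by_cases h1 : a.1 = b.1
      · have h2 : a.2 ≠ b.2 := fun h2 => hab (Prod.ext h1 h2)
        obtain ⟨p, hp⟩ := Function.ne_iff.1 h2
        exact Finset.prod_eq_zero (Finset.mem_univ p)
          (if_neg fun hc => hp (hc.2.symm.trans hc.1))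
      · obtain ⟨p, hp⟩ := Function.ne_iff.1 h1
        refine Finset.prod_eq_zero (Finset.mem_univ p) ?_
        rw [Matrix.trace_single_eq_of_ne _ _ _ (Ne.symm hp), ite_self]
  rw [h, Matrix.trace]
  simp only [Matrix.diag, Matrix.diagonal_mul, ite_mul, one_mul, zero_mul, Fintype.sum_prod_type,
    Finset.sum_ite_eq, Finset.mem_univ, if_true]

theorem trace_procMap (W : ProcMatrix P dI dO) (L : LocalOps P dI dO dS dX) (v : Option P)
    (x : Idx (procDim dI dO dS dX) (Finset.univ.filter fun s => procConsumer s = some v)) :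
    (procMap W L v (Matrix.single x x 1)).trace = 1 := by
  cases v with
  | none =>
    refine Eq.trans (Finset.sum_congr rfl fun y _ => ofKernel_apply_single _ _ _ _ _) ?_
    rw [← W.sum_diag fun p => x ⟨.labOut p, mem_wires rfl⟩]
    refine Fintype.sum_bijective
      (fun (y : Idx (procDim dI dO dS dX) (Finset.univ.filter fun s => procProducer s = some none))
        p => y ⟨.labIn p, mem_wires rfl⟩) ⟨fun y y' h => ?_, fun i => ?_⟩ _ _ fun y => rfl
    · funext ⟨s, hs⟩
      cases s with
      | labIn p => exact congrFun h p
      | labOut p => exact absurd (Finset.mem_filter.1 hs).2 (by simp [procProducer])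
      | setting p => exact absurd (Finset.mem_filter.1 hs).2 (by simp [procProducer])
      | outcome p => exact absurd (Finset.mem_filter.1 hs).2 (by simp [procProducer])
    · refine ⟨fun s => match s with
        | ⟨.labIn p, _⟩ => i p
        | ⟨.labOut p, hs⟩ => absurd (Finset.mem_filter.1 hs).2 (by simp [procProducer])
        | ⟨.setting p, hs⟩ => absurd (Finset.mem_filter.1 hs).2 (by simp [procProducer])
        | ⟨.outcome p, hs⟩ => absurd (Finset.mem_filter.1 hs).2 (by simp [procProducer]), rfl⟩
  | some q =>
    have hq : ∀ {p}, some (some p) = some (some q) → q = p := fun h =>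
      (Option.some.inj (Option.some.inj h)).symm
    refine Eq.trans (Finset.sum_congr rfl fun y _ => ofKernel_apply_single _ _ _ _ _) ?_
    refine Eq.trans ?_ (((L.cptp q).2 (Matrix.single
          (x ⟨.labIn q, mem_wires rfl⟩, x ⟨.setting q, mem_wires rfl⟩)
          (x ⟨.labIn q, mem_wires rfl⟩, x ⟨.setting q, mem_wires rfl⟩) 1)).trans
      (Matrix.trace_single_eq_same _ _))
    refine Fintype.sum_bijective
      (fun (y : Idx (procDim dI dO dS dX)
          (Finset.univ.filter fun s => procProducer s = some (some q))) =>
        ((y ⟨.labOut q, mem_wires rfl⟩, y ⟨.outcome q, mem_wires rfl⟩) :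
          Fin (dO q) × Fin (dX q))) ⟨fun y y' h => ?_, fun i => ?_⟩ _ _ fun y => rfl
    · funext ⟨s, hs⟩
      cases s with
      | labIn p => exact absurd (Finset.mem_filter.1 hs).2 (by simp [procProducer])
      | setting p => exact absurd (Finset.mem_filter.1 hs).2 (by simp [procProducer])
      | labOut p =>
        obtain rfl := hq (Finset.mem_filter.1 hs).2
        exact congrArg Prod.fst h
      | outcome p =>
        obtain rfl := hq (Finset.mem_filter.1 hs).2
        exact congrArg Prod.snd h
    · refine ⟨fun s => match s with
        | ⟨.labIn p, hs⟩ => absurd (Finset.mem_filter.1 hs).2 (by simp [procProducer])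
        | ⟨.labOut p, hs⟩ => hq (Finset.mem_filter.1 hs).2 ▸ i.1
        | ⟨.setting p, hs⟩ => absurd (Finset.mem_filter.1 hs).2 (by simp [procProducer])
        | ⟨.outcome p, hs⟩ => hq (Finset.mem_filter.1 hs).2 ▸ i.2, rfl⟩

end ProcNetwork

/-! ### Fine-grained maps under relativistic causality. -/

theorem Realisation.RelativisticCausality.not_signals_empty {𝔑 : Network} {T : Type*}
    [PartialOrder T] {R : Realisation 𝔑 T} (h : R.RelativisticCausality) (S : R.fine.Sub)
    (A : Finset R.fine.Sys) : ¬ Signals S.induced A ∅ := fun hs => by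
  obtain ⟨-, -, t, ht, -⟩ := h A ∅ (Finset.disjoint_empty_right A) ⟨S, hs⟩
  exact absurd ht (Finset.notMem_empty t)

/-- Signalling to the empty set would require a path ending in a system of that set, so
`IsFineGraining.isTP` applies; a diagonal unit serves as its normalised input. -/
theorem Realisation.RelativisticCausality.isCPTP_corr_single {P : Type} [Fintype P] [DecidableEq P]
    {dI dO dS dX : P → ℕ+} {W : ProcMatrix P dI dO} {L : LocalOps P dI dO dS dX} {T : Type*}
    [PartialOrder T] {R : Realisation (procNetwork W L) T} (h : R.RelativisticCausality)
    (v : Option P) :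
    IsCPTP (R.fg.corr (Network.Sub.single (𝔑 := procNetwork W L) v)).induced := by
  refine ⟨Network.Sub.isCP_induced _, (R.fg.fine _).isTP (h.not_signals_empty _ _)
    (X := Matrix.single (baseIdx _ _) (baseIdx _ _) 1) (Matrix.trace_single_eq_same _ _) ?_⟩
  obtain ⟨a, ha⟩ := Network.Sub.trace_induced_single (𝔑 := procNetwork W L) v (baseIdx _ _)
  exact ha.trans (trace_procMap W L v a)

/-! ### Closing a map with local operations, and eliminating parties. -/

section LocalOperations

variable {σ : Type} {d : σ → ℕ+} {A B : Finset σ} {P : Type} [Fintype P]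

/-- The operator on the systems in `A` which the local maps `M` assign to `|i'⟩⟨i|`. -/
def locProd (a : P ≃ A) (b : P ≃ B) (M : ∀ p, LocalMap (d (b p)) (d (a p))) (i' i : Idx d B) :
    Matrix (Idx d A) (Idx d A) ℂ :=
  Matrix.of fun o' o => ∏ p, M p (Matrix.single (i' (b p)) (i (b p)) 1) (o' (a p)) (o (a p))

theorem eq_res_singleton_iff {s : σ} (h : {s} ⊆ A) (z : Idx d ({s} : Finset σ)) (o : Idx d A) :
    z = res h o ↔ z ⟨s, Finset.mem_singleton_self s⟩ = o ⟨s, h (Finset.mem_singleton_self s)⟩ := by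
  constructor
  · rintro rfl
    rfl
  · intro hz
    funext ⟨s', hs'⟩
    obtain rfl := Finset.mem_singleton.1 hs'
    exact hz

variable (a : P ≃ A) (b : P ≃ B) {M : ∀ p, LocalMap (d (b p)) (d (a p))}

theorem locProd_eq_zero {i' i : Idx d B} {p : P} {z : Fin (d (a p))} (hp : M p = prep z)
    (hi : i' (b p) ≠ i (b p)) : locProd a b M i' i = 0 := by
  ext o' o
  refine Finset.prod_eq_zero (Finset.mem_univ p) ?_
  rw [hp, prep_apply, Matrix.trace_single_eq_of_ne _ _ _ hi, zero_smul, Matrix.zero_apply]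

/-- A discard-and-prepare party sees its input only through the trace, so it does not distinguish
between diagonal units. -/
theorem locProd_congr {i' i j' j : Idx d B} {U : Finset P}
    (hM : ∀ p ∈ U, ∃ z, M p = prep z) (hi : ∀ p ∈ U, i' (b p) = i (b p))
    (hj : ∀ p ∈ U, j' (b p) = j (b p)) (h' : ∀ p ∉ U, i' (b p) = j' (b p))
    (h : ∀ p ∉ U, i (b p) = j (b p)) : locProd a b M i' i = locProd a b M j' j := by
  ext o' o
  refine Finset.prod_congr rfl fun p _ => ?_
  by_cases hp : p ∈ U
  · obtain ⟨z, hz⟩ := hM p hp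
    rw [hz, prep_apply, prep_apply, hi p hp, hj p hp, Matrix.trace_single_eq_same,
      Matrix.trace_single_eq_same]
  · rw [h p hp, h' p hp]

variable [DecidableEq σ]

/-- The number obtained by joining `Φ` with the local maps `M` along all systems. -/
def opProb (Φ : Op d A d B) (M : ∀ p, LocalMap (d (b p)) (d (a p))) : ℂ :=
  ∑ i', ∑ i, Φ (locProd a b M i' i) i' i

theorem opProb_prep (Φ : Op d A d B) (o : Idx d A) :
    opProb a b Φ (fun p => prep (o (a p))) = (Φ (Matrix.single o o 1)).trace := by
  refine Finset.sum_congr rfl fun i' _ => ?_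
  rw [Fintype.sum_eq_single i']
  · have h : locProd a b (fun p => prep (o (a p))) i' i' = Matrix.single o o (1 : ℂ) := by
      ext x' x
      simp only [locProd, Matrix.of_apply, prep_apply, Matrix.trace_single_eq_same, one_smul,
        Matrix.single_apply]
      by_cases hx : o = x' ∧ o = x
      · obtain ⟨rfl, rfl⟩ := hx
        simp
      · rw [if_neg hx]
        obtain ⟨p, hp⟩ : ∃ p, ¬ (o (a p) = x' (a p) ∧ o (a p) = x (a p)) := by
          by_contra! hc
          exact hx ⟨funext fun s => by obtain ⟨p, rfl⟩ := a.surjective s; exact (hc p).1,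
            funext fun s => by obtain ⟨p, rfl⟩ := a.surjective s; exact (hc p).2⟩
        exact Finset.prod_eq_zero (Finset.mem_univ p) (if_neg hp)
    rw [h]
    rfl
  · intro i hi
    obtain ⟨s, hs⟩ := Function.ne_iff.1 hi
    obtain ⟨p, rfl⟩ := b.surjective s
    rw [locProd_eq_zero a b rfl (Ne.symm hs), map_zero, Matrix.zero_apply]

theorem sum_idx_singleton (s : σ) (f : Fin (d s) → ℂ) :
    ∑ u : Idx d ({s} : Finset σ), f (u ⟨s, Finset.mem_singleton_self s⟩) = ∑ t, f t := by
  refine Fintype.sum_bijective (fun u : Idx d ({s} : Finset σ) =>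
    u ⟨s, Finset.mem_singleton_self s⟩) ⟨fun u u' h => ?_, fun t => ?_⟩ _ _ fun u => rfl
  · funext ⟨s', hs'⟩
    obtain rfl := Finset.mem_singleton.1 hs'
    exact h
  · exact ⟨fun s' => (Finset.mem_singleton.1 s'.2).symm ▸ t, rfl⟩

variable (M)

/-- Converts an intervention on the wire `a k`, as in the definition of signalling, into a change of
the local map of party `k`. -/
theorem actOn_locProd [DecidableEq P] (k : P) (h : {(a k).1} ⊆ A) (z : Idx d ({(a k).1} : Finset σ))
    (i' i : Idx d B) :
    actOn h (prep z) (locProd a b M i' i) =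
      locProd a b (Function.update M k (prep (z ⟨a k, Finset.mem_singleton_self _⟩) ∘ₗ M k))
        i' i := by
  ext o' o
  have hne : ∀ p ∈ Finset.univ.erase k, ∀ (u : Idx d ({(a k).1} : Finset σ)) (x : Idx d A),
      glue h u (res Finset.sdiff_subset x) (a p) = x (a p) := by
    intro p hp u x
    have : (a p).1 ∉ ({(a k).1} : Finset σ) := fun hc =>
      Finset.ne_of_mem_erase hp (a.injective (Subtype.ext (Finset.mem_singleton.1 hc)))
    simp [glue, this, res]
  have heq : ∀ (u : Idx d ({(a k).1} : Finset σ)) (x : Idx d A),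
      glue h u (res Finset.sdiff_subset x) (a k) = u ⟨a k, Finset.mem_singleton_self _⟩ := by
    intro u x
    simp [glue]
  simp only [actOn, LinearMap.coe_mk, AddHom.coe_mk, Matrix.of_apply, prep_apply,
    Matrix.smul_apply, smul_eq_mul, locProd]
  rw [← Finset.mul_prod_erase Finset.univ _ (Finset.mem_univ k), Function.update_self,
    LinearMap.comp_apply, prep_apply, Matrix.smul_apply, smul_eq_mul]
  have hrest : ∏ p ∈ Finset.univ.erase k,
      Function.update M k (prep (z ⟨a k, Finset.mem_singleton_self _⟩) ∘ₗ M k) p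
        (Matrix.single (i' (b p)) (i (b p)) 1) (o' (a p)) (o (a p)) =
      ∏ p ∈ Finset.univ.erase k,
        M p (Matrix.single (i' (b p)) (i (b p)) 1) (o' (a p)) (o (a p)) :=
    Finset.prod_congr rfl fun p hp => by
      rw [Function.update_of_ne (Finset.ne_of_mem_erase hp)]
  rw [hrest]
  -- Tracing out the wire of `k` affects only the factor of `k`; the other factors come out of the
  -- sum.
  have htr : (Matrix.of fun u u' : Idx d ({(a k).1} : Finset σ) =>
      ∏ p, M p (Matrix.single (i' (b p)) (i (b p)) 1)
        (glue h u (res Finset.sdiff_subset o') (a p))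
        (glue h u' (res Finset.sdiff_subset o) (a p))).trace =
      (M k (Matrix.single (i' (b k)) (i (b k)) 1)).trace * ∏ p ∈ Finset.univ.erase k,
        M p (Matrix.single (i' (b p)) (i (b p)) 1) (o' (a p)) (o (a p)) := by
    rw [Matrix.trace, Matrix.trace, ← sum_idx_singleton, Finset.sum_mul]
    refine Finset.sum_congr rfl fun u _ => ?_
    rw [Matrix.diag, Matrix.of_apply, ← Finset.mul_prod_erase Finset.univ _ (Finset.mem_univ k),
      heq, heq]
    refine congrArg _ (Finset.prod_congr rfl fun p hp => ?_)
    rw [hne p hp, hne p hp]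
  rw [htr, mul_right_comm]
  simp only [Matrix.single_apply, eq_res_singleton_iff]

variable {M}

variable [DecidableEq P]

/-- The inputs of the parties outside `U`. -/
def labsOutside (U : Finset P) : Finset σ := Uᶜ.image fun p => (b p).1

theorem labsOutside_subset (U : Finset P) : labsOutside b U ⊆ B := fun s hs => by
  obtain ⟨p, -, rfl⟩ := Finset.mem_image.1 hs
  exact (b p).2

theorem mem_labsOutside {U : Finset P} {p : P} : (b p).1 ∈ labsOutside b U ↔ p ∉ U := by
  rw [labsOutside, Finset.mem_image]
  constructor
  · rintro ⟨q, hq, hqp⟩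
    rw [← b.injective (Subtype.ext hqp)]
    exact Finset.mem_compl.1 hq
  · exact fun hp => ⟨p, Finset.mem_compl.2 hp, rfl⟩

/-- The parties in `U` discard their inputs, so `Φ` enters only through its reduced output on the
inputs of the others. The labels of `U` inside `locProd` are irrelevant once diagonal, and `baseIdx`
is an arbitrary choice for them. -/
theorem opProb_eq_sum_ptrace (Φ : Op d A d B) {U : Finset P} (hM : ∀ p ∈ U, ∃ z, M p = prep z) :
    opProb a b Φ M = ∑ y', ∑ y, ptrace d (labsOutside_subset b U)
      (Φ (locProd a b M (glue (labsOutside_subset b U) y' (baseIdx d _))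
        (glue (labsOutside_subset b U) y (baseIdx d _)))) y' y := by
  have hin : ∀ (p : P) (hp : (b p).1 ∉ labsOutside b U) (y : Idx d (labsOutside b U))
      (w : Idx d (B \ labsOutside b U)), glue (labsOutside_subset b U) y w (b p) =
        w ⟨b p, Finset.mem_sdiff.2 ⟨(b p).2, hp⟩⟩ := fun p hp y w => dif_neg hp
  have hout : ∀ (p : P) (hp : (b p).1 ∈ labsOutside b U) (y : Idx d (labsOutside b U))
      (w : Idx d (B \ labsOutside b U)), glue (labsOutside_subset b U) y w (b p) = y ⟨b p, hp⟩ :=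
    fun p hp y w => dif_pos hp
  have hU : ∀ p ∈ U, (b p).1 ∉ labsOutside b U := fun p hp h => (mem_labsOutside b).1 h hp
  rw [opProb, sum_glue (labsOutside_subset b U)]
  refine Finset.sum_congr rfl fun y' _ => ?_
  rw [Finset.sum_congr rfl fun w' _ => sum_glue (labsOutside_subset b U) _, Finset.sum_comm]
  refine Finset.sum_congr rfl fun y _ => ?_
  simp only [ptrace, LinearMap.coe_mk, AddHom.coe_mk, Matrix.of_apply]
  refine Finset.sum_congr rfl fun w' _ => ?_
  rw [Fintype.sum_eq_single w']
  · rw [locProd_congr a b hM (j' := glue (labsOutside_subset b U) y' (baseIdx d _))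
      (j := glue (labsOutside_subset b U) y (baseIdx d _))]
    · intro p hp
      rw [hin p (hU p hp), hin p (hU p hp)]
    · intro p hp
      rw [hin p (hU p hp), hin p (hU p hp)]
    · intro p hp
      rw [hout p ((mem_labsOutside b).2 hp), hout p ((mem_labsOutside b).2 hp)]
    · intro p hp
      rw [hout p ((mem_labsOutside b).2 hp), hout p ((mem_labsOutside b).2 hp)]
  -- Labels that differ at a party in `U` give an off-diagonal unit, whose trace vanishes.
  · intro w hw
    obtain ⟨⟨s, hs⟩, hne⟩ := Function.ne_iff.1 hw
    obtain ⟨p, hp⟩ := b.surjective ⟨s, (Finset.mem_sdiff.1 hs).1⟩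
    obtain rfl : (b p).1 = s := congrArg Subtype.val hp
    have hpU : p ∈ U := by
      by_contra h
      exact (Finset.mem_sdiff.1 hs).2 ((mem_labsOutside b).2 h)
    obtain ⟨z, hz⟩ := hM p hpU
    rw [locProd_eq_zero a b hz, map_zero, Matrix.zero_apply]
    rw [hin p (hU p hpU), hin p (hU p hpU)]
    exact hne.symm

theorem opProb_update_of_not_signals {Φ : Op d A d B} {U : Finset P} {k : P}
    (hns : ¬ Signals Φ {(a k).1} (labsOutside b U)) (hk : k ∉ U)
    (hM : ∀ p ∈ U, ∃ z, M p = prep z) (z : Fin (d (a k))) :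
    opProb a b Φ M = opProb a b Φ (Function.update M k (prep z ∘ₗ M k)) := by
  have hk' : {(a k).1} ⊆ A := Finset.singleton_subset_iff.2 (a k).2
  -- The state `z` read as a basis label of the one-element set of systems, the form in which the
  -- intervention is applied.
  let ζ : Idx d ({(a k).1} : Finset σ) := fun s => (Finset.mem_singleton.1 s.2).symm ▸ z
  have hM' : ∀ p ∈ U, ∃ z', Function.update M k (prep z ∘ₗ M k) p = prep z' := fun p hp => by
    rw [Function.update_of_ne fun h : p = k => hk (h ▸ hp)]
    exact hM p hp
  rw [opProb_eq_sum_ptrace a b Φ hM, opProb_eq_sum_ptrace a b Φ hM']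
  refine Finset.sum_congr rfl fun y' _ => Finset.sum_congr rfl fun y _ => ?_
  rw [ptrace_eq_of_not_signals hns hk' (labsOutside_subset b U) (isCPTP_prep ζ),
    actOn_locProd a b M k hk' ζ]

/-- `U` is closed under futures. Removing an earliest member `k` keeps it so; by induction the
remaining parties of `U`, among them all those after `k`, already discard their inputs, so the
output of `k` has no influence. -/
theorem opProb_eq_piecewise {Φ : Op d A d B} {r : P → P → Prop} (hirr : ∀ p, ¬ r p p)
    (htrans : ∀ p q s, r p q → r q s → r p s)
    (hns : ∀ (k : P) (U : Finset P), (∀ l, r k l → l ∈ U) →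
      ¬ Signals Φ {(a k).1} (labsOutside b U))
    (z : ∀ p, Fin (d (a p))) (U : Finset P) (hU : ∀ k ∈ U, ∀ l, r k l → l ∈ U)
    (hM : ∀ p ∈ U, IsTP (M p)) :
    opProb a b Φ M = opProb a b Φ (U.piecewise (fun p => prep (z p)) M) := by
  induction U using Finset.strongInduction with
  | H U ih =>
    obtain rfl | hne := U.eq_empty_or_nonempty
    · rw [Finset.piecewise_empty]
    have : IsTrans P r := ⟨htrans⟩
    have : Std.Irrefl r := ⟨hirr⟩
    obtain ⟨k, hk, hmin⟩ := (Finite.wellFounded_of_trans_of_irrefl r).has_min (U : Set P) hne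
    have hk : k ∈ U := hk
    -- Minimality of `k` makes `U.erase k` future-closed; irreflexivity ensures that it contains the
    -- whole future of `k`. Trace preservation then absorbs `M k` into the preparation.
    rw [ih (U.erase k) (Finset.erase_ssubset hk)
        (fun p hp l hl => Finset.mem_erase.2 ⟨fun h => hmin p (Finset.mem_of_mem_erase hp) (h ▸ hl),
          hU p (Finset.mem_of_mem_erase hp) l hl⟩)
        fun p hp => hM p (Finset.mem_of_mem_erase hp),
      opProb_update_of_not_signals a b (U := U.erase k) (k := k)
        (hns k _ fun l hl => Finset.mem_erase.2 ⟨fun h => hirr k (h ▸ hl), hU k hk l hl⟩)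
        (Finset.notMem_erase k U)
        (fun p hp => ⟨z p, Finset.piecewise_eq_of_mem _ _ _ hp⟩) (z k),
      Finset.piecewise_eq_of_notMem _ _ _ (Finset.notMem_erase k U),
      prep_comp_of_isTP (hM k hk), ← Finset.piecewise_insert, Finset.insert_erase hk]

end LocalOperations

/-! ### The process matrix of a map with ordered signalling. -/

section ProcessOfMap

variable {σ : Type} {d : σ → ℕ+} {A B : Finset σ} {P : Type}

/-- Basis labels of the systems in `A`, listed by the parties. -/
def labEquiv (a : P ≃ A) : (∀ p, Fin (d (a p))) ≃ Idx d A :=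
  Equiv.piCongrLeft (fun s : A => Fin (d s)) a

theorem labEquiv_apply (a : P ≃ A) (o : ∀ p, Fin (d (a p))) (p : P) : labEquiv a o (a p) = o p :=
  Equiv.piCongrLeft_apply_apply (fun s : A => Fin (d s)) a o p

theorem labEquiv_comp (a : P ≃ A) (o : Idx d A) : labEquiv a (fun p => o (a p)) = o := by
  funext s
  obtain ⟨p, rfl⟩ := a.surjective s
  exact labEquiv_apply a _ p

variable [DecidableEq σ] [Fintype P] [DecidableEq P] (a : P ≃ A) (b : P ≃ B)

/-- The matrix elements of `Φ`, indexed by the lab inputs and outputs of the parties. -/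
def mapMat (Φ : Op d A d B) :
    Matrix ((∀ p, Fin (d (b p))) × (∀ p, Fin (d (a p))))
      ((∀ p, Fin (d (b p))) × (∀ p, Fin (d (a p)))) ℂ :=
  (choi Φ).submatrix (fun q => (labEquiv a q.2, labEquiv b q.1))
    fun q => (labEquiv a q.2, labEquiv b q.1)

theorem trace_localChoi_mul_mapMat (Φ : Op d A d B) (M : ∀ p, LocalMap (d (b p)) (d (a p))) :
    (localChoi M * mapMat a b Φ).trace = opProb a b Φ M := by
  have h : ∀ i' i, Φ (locProd a b M i' i) i' i =
      ∑ o', ∑ o, locProd a b M i' i o' o * Φ (Matrix.single o' o 1) i' i :=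
    fun i' i => apply_eq_sum_single Φ _ i' i
  simp only [opProb, h]
  simp only [← (labEquiv b).sum_comp, ← (labEquiv a).sum_comp]
  simp only [Matrix.trace, Matrix.diag, Matrix.mul_apply]
  rw [Finset.sum_comm]
  simp only [Fintype.sum_prod_type]
  refine Finset.sum_congr rfl fun i' _ => ?_
  rw [Finset.sum_comm]
  refine Finset.sum_congr rfl fun i _ => Finset.sum_congr rfl fun o' _ =>
    Finset.sum_congr rfl fun o _ => ?_
  simp only [locProd, localChoi, Matrix.of_apply, labEquiv_apply]
  rfl

/-- Multilinearity in the local maps: it turns a marginal over outcomes into one evaluation with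
coarse-grained instruments. -/
theorem opProb_sum (Φ : Op d A d B) {κ : P → Type} [∀ p, DecidableEq (κ p)]
    (T : ∀ p, Finset (κ p)) (J : ∀ p, κ p → LocalMap (d (b p)) (d (a p))) :
    opProb a b Φ (fun p => ∑ t ∈ T p, J p t) =
      ∑ y ∈ Fintype.piFinset T, opProb a b Φ fun p => J p (y p) := by
  have h : ∀ i' i, locProd a b (fun p => ∑ t ∈ T p, J p t) i' i =
      ∑ y ∈ Fintype.piFinset T, locProd a b (fun p => J p (y p)) i' i := by
    intro i' i
    ext o' o
    simp only [locProd, Matrix.of_apply, LinearMap.sum_apply, Matrix.sum_apply]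
    exact Finset.prod_univ_sum _ _
  simp only [opProb, h, map_sum, Matrix.sum_apply]
  rw [Finset.sum_comm]
  rw [Finset.sum_congr rfl fun i _ => Finset.sum_comm, Finset.sum_comm]
  exact Finset.sum_congr rfl fun y _ => Finset.sum_comm

/-- The process matrix with Choi matrix that of `Φ`. -/
def ProcMatrix.ofMap (Φ : Op d A d B) (hΦ : IsCP Φ)
    (hnorm : ∀ M : ∀ p, LocalMap (d (b p)) (d (a p)), (∀ p, IsCPTP (M p)) → opProb a b Φ M = 1) :
    ProcMatrix P (fun p => d (b p)) (fun p => d (a p)) where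
  mat := mapMat a b Φ
  posSemidef := (choi_posSemidef hΦ).submatrix _
  normalised M hM := (trace_localChoi_mul_mapMat a b Φ M).trans (hnorm M hM)

variable {a b}

theorem opProb_eq_one {Φ : Op d A d B} (hTP : IsTP Φ) {r : P → P → Prop} (hirr : ∀ p, ¬ r p p)
    (htrans : ∀ p q s, r p q → r q s → r p s)
    (hns : ∀ (k : P) (U : Finset P), (∀ l, r k l → l ∈ U) →
      ¬ Signals Φ {(a k).1} (labsOutside b U))
    (M : ∀ p, LocalMap (d (b p)) (d (a p))) (hM : ∀ p, IsCPTP (M p)) : opProb a b Φ M = 1 := by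
  rw [opProb_eq_piecewise a b hirr htrans hns (fun p => baseIdx d A (a p)) Finset.univ
    (fun _ _ _ _ => Finset.mem_univ _) fun p _ => (hM p).2, Finset.piecewise_univ, opProb_prep,
    hTP, Matrix.trace_single_eq_same]

theorem ProcMatrix.isFixedOrder_ofMap {Φ : Op d A d B} (hΦ : IsCP Φ)
    (hnorm : ∀ M : ∀ p, LocalMap (d (b p)) (d (a p)), (∀ p, IsCPTP (M p)) → opProb a b Φ M = 1)
    {r : P → P → Prop} (hirr : ∀ p, ¬ r p p)
    (htrans : ∀ p q s, r p q → r q s → r p s)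
    (hns : ∀ (k : P) (U : Finset P), (∀ l, r k l → l ∈ U) →
      ¬ Signals Φ {(a k).1} (labsOutside b U)) :
    (ProcMatrix.ofMap a b Φ hΦ hnorm).IsFixedOrder := by
  refine ⟨r, hirr, htrans, fun L hL k J J' hJ hJ' hJJ' x => ?_⟩
  -- Outcomes are fixed inside `L` and summed outside, which makes the index set of the marginal a
  -- product.
  let T : ∀ p, Finset (Fin (k p)) := fun p => if p ∈ L then {x p} else Finset.univ
  have hT : (Finset.univ.filter fun y : ∀ p, Fin (k p) => ∀ p ∈ L, y p = x p) =
      Fintype.piFinset T := by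
    ext y
    rw [Finset.mem_filter, Fintype.mem_piFinset, and_iff_right (Finset.mem_univ y)]
    refine forall_congr' fun p => ?_
    by_cases hp : p ∈ L <;> simp [T, hp]
  have hsum : ∀ J : ∀ p, Fin (k p) → LocalMap (d (b p)) (d (a p)), (∀ p, IsInstrument (J p)) →
      (∑ y : ∀ p, Fin (k p) with ∀ p ∈ L, y p = x p,
        (ProcMatrix.ofMap a b Φ hΦ hnorm).prob fun p => J p (y p)) =
      opProb a b Φ (Lᶜ.piecewise (fun p => prep (baseIdx d A (a p))) fun p => J p (x p)) := by
    intro J hJ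
    rw [hT]
    refine (Finset.sum_congr rfl fun y _ => trace_localChoi_mul_mapMat a b Φ _).trans ?_
    rw [← opProb_sum, opProb_eq_piecewise a b hirr htrans hns (fun p => baseIdx d A (a p)) Lᶜ]
    · congr 1
      funext p
      by_cases hp : p ∈ L
      · have hp' : p ∉ Lᶜ := fun h => Finset.mem_compl.1 h hp
        rw [Finset.piecewise_eq_of_notMem _ _ _ hp', Finset.piecewise_eq_of_notMem _ _ _ hp']
        simp [T, hp]
      · have hp' : p ∈ Lᶜ := Finset.mem_compl.2 hp
        rw [Finset.piecewise_eq_of_mem _ _ _ hp', Finset.piecewise_eq_of_mem _ _ _ hp']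
    -- The complement of a past-closed set is future-closed.
    · exact fun p hp l hl => Finset.mem_compl.2 fun h => Finset.mem_compl.1 hp (hL l h p hl)
    · intro p hp
      have : T p = Finset.univ := if_neg (Finset.mem_compl.1 hp)
      rw [this]
      exact (hJ p).2
  rw [hsum J hJ, hsum J' hJ']
  congr 1
  funext p
  by_cases hp : p ∈ L
  · have hp' : p ∉ Lᶜ := fun h => Finset.mem_compl.1 h hp
    rw [Finset.piecewise_eq_of_notMem _ _ _ hp', Finset.piecewise_eq_of_notMem _ _ _ hp',
      hJJ' p hp]
  · have hp' : p ∈ Lᶜ := Finset.mem_compl.2 hp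
    rw [Finset.piecewise_eq_of_mem _ _ _ hp', Finset.piecewise_eq_of_mem _ _ _ hp']

end ProcessOfMap

/-! ### Fine-grained systems of a family of coarse systems. -/

section Correspondence

variable {𝔑 𝔑f : Network} (G : FineGraining 𝔑 𝔑f)

theorem FineGraining.mem_biUnion_iff {s : 𝔑.Sys} {t : 𝔑f.Sys} (ht : t ∈ G.F s)
    (I : Finset 𝔑.Sys) : t ∈ I.biUnion G.F ↔ s ∈ I := by
  refine ⟨fun h => ?_, fun h => Finset.mem_biUnion.2 ⟨s, h, ht⟩⟩
  obtain ⟨s', hs', ht'⟩ := Finset.mem_biUnion.1 h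
  by_cases hss : s = s'
  · exact hss ▸ hs'
  · exact absurd ht' (Finset.disjoint_left.1 (G.F_disjoint s s' hss) ht)

theorem FineGraining.eq_of_mem {s s' : 𝔑.Sys} {t : 𝔑f.Sys} (ht : t ∈ G.F s) (ht' : t ∈ G.F s') :
    s = s' := by
  by_contra h
  exact Finset.disjoint_left.1 (G.F_disjoint s s' h) ht ht'

/-- The systems into which a family of distinct systems is fine-grained. -/
noncomputable def FineGraining.sigmaEquiv {P : Type} {f : P → 𝔑.Sys} (hf : Function.Injective f)
    {B : Finset 𝔑f.Sys} (hB : ∀ t, t ∈ B ↔ ∃ p, t ∈ G.F (f p)) : (Σ p, G.F (f p)) ≃ B :=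
  Equiv.ofBijective (fun x => ⟨x.2.1, (hB _).2 ⟨x.1, x.2.2⟩⟩) <| by
    constructor
    · rintro ⟨p, t, ht⟩ ⟨q, t', ht'⟩ h
      obtain rfl : t = t' := congrArg Subtype.val h
      obtain rfl := hf (G.eq_of_mem ht ht')
      rfl
    · rintro ⟨t, ht⟩
      obtain ⟨p, hp⟩ := (hB t).1 ht
      exact ⟨⟨p, t, hp⟩, rfl⟩

end Correspondence

/-! ### Wires of a process network. -/

section ProcNetwork

variable {P : Type} [Fintype P] [DecidableEq P] {dI dO dS dX : P → ℕ+} (W : ProcMatrix P dI dO)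
  (L : LocalOps P dI dO dS dX)

theorem mem_inputs_single (v : Option P) (s : ProcSys P) :
    s ∈ (Network.Sub.single (𝔑 := procNetwork W L) v).inputs ↔ procConsumer s = some v := by
  refine (Finset.mem_sdiff.trans (and_iff_left (Finset.notMem_empty s))).trans
    ((Finset.mem_filter.trans (and_iff_right (Finset.mem_univ s))).trans ?_)
  exact ⟨fun ⟨w, hw, h⟩ => (Finset.mem_singleton.1 hw) ▸ h,
    fun h => ⟨v, Finset.mem_singleton_self v, h⟩⟩

theorem mem_outputs_single (v : Option P) (s : ProcSys P) :
    s ∈ (Network.Sub.single (𝔑 := procNetwork W L) v).outputs ↔ procProducer s = some v := by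
  refine (Finset.mem_sdiff.trans (and_iff_left (Finset.notMem_empty s))).trans
    ((Finset.mem_filter.trans (and_iff_right (Finset.mem_univ s))).trans ?_)
  exact ⟨fun ⟨w, hw, h⟩ => (Finset.mem_singleton.1 hw) ▸ h,
    fun h => ⟨v, Finset.mem_singleton_self v, h⟩⟩

theorem mem_comps_full (s : ProcSys P) :
    s ∈ (Network.Sub.full (procNetwork W L)).comps ↔
      (∃ p, s = .labIn p) ∨ ∃ p, s = .labOut p := by
  refine Finset.mem_inter.trans ((and_congr
    (Finset.mem_filter.trans (and_iff_right (Finset.mem_univ s)))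
    (Finset.mem_filter.trans (and_iff_right (Finset.mem_univ s)))).trans ?_)
  constructor
  · rintro ⟨⟨v, -, hv⟩, w, -, hw⟩
    cases s with
    | labIn p => exact Or.inl ⟨p, rfl⟩
    | labOut p => exact Or.inr ⟨p, rfl⟩
    | setting p => exact absurd hw (by simp [procNetwork, procProducer])
    | outcome p => exact absurd hv (by simp [procNetwork, procConsumer])
  · rintro (⟨p, rfl⟩ | ⟨p, rfl⟩)
    · exact ⟨⟨some p, Finset.mem_univ _, rfl⟩, none, Finset.mem_univ _, rfl⟩
    · exact ⟨⟨none, Finset.mem_univ _, rfl⟩, some p, Finset.mem_univ _, rfl⟩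

end ProcNetwork

/-! ### Construction of the fixed order explanation. -/

section Explanation

variable {N : ℕ} {dI dO dS dX : Fin N → ℕ+} {W : ProcMatrix (Fin N) dI dO}
  {L : LocalOps (Fin N) dI dO dS dX} {T : Type*} [PartialOrder T]

theorem hasFixedOrderExplanation (R : Realisation (procNetwork W L) T)
    (hio : InputOutputCorrespondence R) (hrc : R.RelativisticCausality) :
    HasFixedOrderExplanation R := by
  choose e he using hio
  let C : Option (Fin N) → R.fine.Sub :=
    fun v => R.fg.corr (Network.Sub.single (𝔑 := procNetwork W L) v)
  have hC_in : ∀ v, (C v).inputs =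
      (Network.Sub.single (𝔑 := procNetwork W L) v).inputs.biUnion R.fg.F :=
    fun v => (R.fg.fine _).1
  have hC_out : ∀ v, (C v).outputs =
      (Network.Sub.single (𝔑 := procNetwork W L) v).outputs.biUnion R.fg.F :=
    fun v => (R.fg.fine _).2.1
  have hA : ∀ t, t ∈ (C none).inputs ↔ ∃ p, t ∈ R.fg.F (ProcSys.labOut p) := fun t => by
    rw [hC_in, Finset.mem_biUnion]
    constructor
    · rintro ⟨s, hs, ht⟩
      have hs := (mem_inputs_single W L none s).1 hs
      cases s with
      | labOut p => exact ⟨p, ht⟩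
      | labIn p => exact absurd hs (by simp [procConsumer])
      | setting p => exact absurd hs (by simp [procConsumer])
      | outcome p => exact absurd hs (by simp [procConsumer])
    · rintro ⟨p, ht⟩
      exact ⟨_, (mem_inputs_single W L none _).2 rfl, ht⟩
  have hB : ∀ t, t ∈ (C none).outputs ↔ ∃ p, t ∈ R.fg.F (ProcSys.labIn p) := fun t => by
    rw [hC_out, Finset.mem_biUnion]
    constructor
    · rintro ⟨s, hs, ht⟩
      have hs := (mem_outputs_single W L none s).1 hs
      cases s with
      | labIn p => exact ⟨p, ht⟩
      | labOut p => exact absurd hs (by simp [procProducer])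
      | setting p => exact absurd hs (by simp [procProducer])
      | outcome p => exact absurd hs (by simp [procProducer])
    · rintro ⟨p, ht⟩
      exact ⟨_, (mem_outputs_single W L none _).2 rfl, ht⟩
  -- A fine-grained party is an agent with one of its fine-grained lab inputs; `κ` numbers these
  -- parties. Below, `b` gives the lab input and `a` the lab output matched to it by `e`.
  let κ : Fin (Fintype.card (Σ p, R.fg.F (ProcSys.labIn p))) ≃ Σ p, R.fg.F (ProcSys.labIn p) :=
    (Fintype.equivFin _).symm
  let b := κ.trans (R.fg.sigmaEquiv (f := ProcSys.labIn) (fun p q h => by cases h; rfl) hB)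
  let a := κ.trans ((Equiv.sigmaCongrRight e).trans
    (R.fg.sigmaEquiv (f := ProcSys.labOut) (fun p q h => by cases h; rfl) hA))
  have hb : ∀ k, (b k).1 ∈ R.fg.F (ProcSys.labIn (κ k).1) := fun k => (κ k).2.2
  have ha : ∀ k, (a k).1 ∈ R.fg.F (ProcSys.labOut (κ k).1) := fun k => (e _ (κ k).2).2
  have hba : ∀ k, RegionEdge R.fineEmbed (R.fineEmbed (b k).1) (R.fineEmbed (a k).1) :=
    fun k => ⟨⟨_, rfl⟩, ⟨_, rfl⟩, he _ (κ k).2⟩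
  -- Relativistic causality speaks only of disjoint sets of systems; lab outputs and inputs are
  -- disjoint because `F` has disjoint values.
  have hne : ∀ k l, (a k).1 ≠ (b l).1 := fun k l h => by
    have := R.fg.eq_of_mem (ha k) (h ▸ hb l)
    cases this
  let r : Fin (Fintype.card (Σ p, R.fg.F (ProcSys.labIn p))) →
      Fin (Fintype.card (Σ p, R.fg.F (ProcSys.labIn p))) → Prop := fun k l =>
    Relation.ReflTransGen (RegionEdge R.fineEmbed) (R.fineEmbed (a k).1) (R.fineEmbed (b l).1)
  -- The edge from input to output of one party provides at least one step, so a returning path is a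
  -- genuine cycle. The same edge bridges the two paths in `htrans`.
  have hirr : ∀ k, ¬ r k k := fun k h => R.acyclic _ (Relation.TransGen.head' (hba k) h)
  have htrans : ∀ k l m, r k l → r l m → r k m := fun k l m hkl hlm =>
    (hkl.tail (hba l)).trans hlm
  have hns : ∀ (k) (U : Finset _), (∀ l, r k l → l ∈ U) →
      ¬ Signals (C none).induced {(a k).1} (labsOutside b U) := by
    intro k U hU hs
    -- Such signalling would yield a path to the input of some `l` outside `U`, that is `r k l`,
    -- although `U` contains the future of `k`.
    obtain ⟨s, hs₁, t, ht, hst⟩ := hrc {(a k).1} (labsOutside b U)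
      (Finset.disjoint_singleton_left.2 fun h => by
        obtain ⟨l, -, hl⟩ := Finset.mem_image.1 h
        exact hne k l hl.symm) ⟨C none, hs⟩
    obtain rfl := Finset.mem_singleton.1 hs₁
    obtain ⟨l, hl, rfl⟩ := Finset.mem_image.1 ht
    exact Finset.mem_compl.1 hl (hU l hst)
  have hcptp : ∀ v, IsCPTP (C v).induced := fun v => hrc.isCPTP_corr_single v
  have hnorm := opProb_eq_one (hcptp none).2 hirr htrans hns
  refine ⟨_, fun k => (κ k).1, fun k => (b k).1, fun k => (a k).1,
    ProcMatrix.ofMap a b (C none).induced (hcptp none).1 hnorm, ?_,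
    ProcMatrix.isFixedOrder_ofMap _ hnorm hirr htrans hns, hb, ha, ⟨?_⟩⟩
  -- Each agent has at least one fine-grained party because the sets `F` are non-empty.
  · have := Fintype.card_le_of_injective
      (fun p : Fin N => (⟨p, ⟨_, (R.fg.F_nonempty (ProcSys.labIn p)).choose_spec⟩⟩ :
        Σ p, R.fg.F (ProcSys.labIn p))) fun p q h => congrArg Sigma.fst h
    rwa [Fintype.card_fin] at this
  have hbimg : (C none).outputs = Finset.univ.image fun k => (b k).1 := by
    ext t
    rw [Finset.mem_image]
    exact ⟨fun ht => (b.surjective ⟨t, ht⟩).imp fun k hk => ⟨Finset.mem_univ k, congrArg _ hk⟩,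
      fun ⟨k, _, hk⟩ => hk ▸ (b k).2⟩
  have haimg : (C none).inputs = Finset.univ.image fun k => (a k).1 := by
    ext t
    rw [Finset.mem_image]
    exact ⟨fun ht => (a.surjective ⟨t, ht⟩).imp fun k hk => ⟨Finset.mem_univ k, congrArg _ hk⟩,
      fun ⟨k, _, hk⟩ => hk ▸ (a k).2⟩
  exact
    { env := C none
      lab := fun q => C (some q)
      labIn_injective := fun k l h => b.injective (Subtype.ext h)
      labOut_injective := fun k l h => a.injective (Subtype.ext h)
      env_inputs := haimg
      env_outputs := hbimg
      env_map := fun o o' i i' => by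
        -- The entries of `mapMat` are those of the induced map with labels listed by party;
        -- relisting a label by systems recovers it.
        change _ = (C none).induced (Matrix.single (labEquiv a fun k => o (a k))
          (labEquiv a fun k => o' (a k)) 1) (labEquiv b fun k => i (b k))
            (labEquiv b fun k => i' (b k))
        rw [labEquiv_comp, labEquiv_comp, labEquiv_comp, labEquiv_comp]
      lab_inputs := fun q k => by
        rw [hC_in, R.fg.mem_biUnion_iff (hb k)]
        refine (mem_inputs_single W L (some q) _).trans ?_
        simp [procConsumer]
      lab_outputs := fun q k => by
        rw [hC_out, R.fg.mem_biUnion_iff (ha k)]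
        refine (mem_outputs_single W L (some q) _).trans ?_
        simp [procProducer]
      lab_cptp := fun q => hcptp (some q)
      env_lab_disjoint := fun q => R.fg.corr_disjoint _ _ (Option.some_ne_none q).symm
      lab_disjoint := fun q q' h => R.fg.corr_disjoint _ _ fun hc => h (Option.some.inj hc)
      maps_eq := by
        rw [R.fg.corr_maps]
        ext v
        simp only [Finset.mem_biUnion, Finset.mem_union, Finset.mem_univ, true_and]
        constructor
        · rintro ⟨_ | q, -, hv⟩
          · exact Or.inl hv
          · exact Or.inr ⟨q, hv⟩
        · rintro (hv | ⟨q, hv⟩)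
          · exact ⟨none, Finset.mem_univ _, hv⟩
          · exact ⟨some q, Finset.mem_univ _, hv⟩
      comps_eq := by
        rw [R.fg.corr_comps, ← hbimg, ← haimg]
        ext t
        simp only [Finset.mem_biUnion, Finset.mem_union, Finset.mem_univ, true_and, hA, hB]
        refine or_congr ⟨?_, ?_⟩ ⟨?_, ?_⟩
        · rintro ⟨_ | q, -, hv⟩
          · exact Or.inl hv
          · exact Or.inr ⟨q, hv⟩
        · rintro (hv | ⟨q, hv⟩)
          · exact ⟨none, Finset.mem_univ _, hv⟩
          · exact ⟨some q, Finset.mem_univ _, hv⟩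
        · rintro ⟨s, hs, ht⟩
          obtain ⟨p, rfl⟩ | ⟨p, rfl⟩ := (mem_comps_full W L s).1 hs
          · exact Or.inl ⟨p, ht⟩
          · exact Or.inr ⟨p, ht⟩
        · rintro (⟨p, ht⟩ | ⟨p, ht⟩)
          · exact ⟨_, (mem_comps_full W L _).2 (Or.inl ⟨p, rfl⟩), ht⟩
          · exact ⟨_, (mem_comps_full W L _).2 (Or.inr ⟨p, rfl⟩), ht⟩ }

end Explanation

end QNet

theorem corollary1 {N : ℕ} {dI dO dS dX : Fin N → ℕ+}
    (W : QNet.ProcMatrix (Fin N) dI dO) (L : QNet.LocalOps (Fin N) dI dO dS dX)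
    {T : Type*} [PartialOrder T] :
    ¬ ∃ R : QNet.Realisation (QNet.procNetwork W L) T,
      QNet.InputOutputCorrespondence R ∧
      R.RelativisticCausality ∧
      ¬ QNet.HasFixedOrderExplanation R := by
  rintro ⟨R, hio, hrc, hno⟩
  exact hno (QNet.hasFixedOrderExplanation R hio hrc)
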